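/- Let $\mathbf{Cat}$ be the 2-category of small categories, $\mathbf{CAT}$ the 2-category of locally small categories, and $J\colon\mathbf{Cat}\to\mathbf{CAT}$ the inclusion. Composition is written $gf$ for "$f$ first". **Relative pseudomonads.** A relative pseudomonad $T$ over a pseudofunctor $J\colon\mathcal C\to\mathcal D$ of bicategories consists of objects $TX\in\mathcal D$ ($X\in\mathcal C$), functors $(-)^*\colon\mathcal D[JX,TY]\to\mathcal D[TX,TY]$, morphisms $i_X\colon JX\to TX$, and invertible 2-cells $\mu_{g,f}\colon(g^*f)^*\to g^*f^*$ and $\eta_f\colon f\to f^*i_X$ (natural in $f,g$) and $\theta_X\colon i_X^*\to 1_{TX}$ such that, up to the associativity and unit isomorphisms of $\mathcal D$, $$(h^*\mu_{g,f})\circ\mu_{h,g^*f}\circ(\mu_{h,g}f)^*=(\mu_{h,g}f^*)\circ\mu_{h^*g,f},\qquad (f^*\theta_X)\circ\mu_{f,i_X}\circ(\eta_f)^*=1 .$$ The relative pseudomonad of presheaves $P$ over $J\colon\mathbf{Cat}\to\mathbf{CAT}$ has $PX=[X^{\mathrm{op}},\mathbf{Set}]$, $i_X$ the Yoneda embedding,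 $F^*$ the left Kan extension of $F\colon X\to PY$ along the Yoneda embedding with unit $\eta_F$, and $\mu,\theta$ determined by the universal property of left Kan extensions. **Algebras.** Let $S$ be a 2-monad (a 2-functor $S$ with 2-natural $m\colon S^2\to S$ and $e\colon 1\to S$ satisfying the monad axioms strictly) on a 2-category $\mathcal D$. A strict algebra is an object $A$ with $a\colon SA\to A$ such that $a\,e_A=1$ and $a\,m_A=a\,S(a)$. A pseudomorphism $(A,a)\to(B,b)$ is a morphism $f\colon A\to B$ with an invertible 2-cell $\bar f\colon b\,S(f)\to f\,a$ such that $\bar f\,e_A$ is the identity and $\bar f\,m_A=(\bar f\,S(a))\circ(b\,S(\bar f))$; it is a strict morphism if $\bar f$ is an identity. A 2-cell $\alpha\colon f\to g$ between pseudomorphisms is an algebra 2-cell if $\bar g\circ(b\,S(\alpha))=(\alpha\,a)\circ\bar f$. **Liftings.** Let $T$ be a relative pseudomonad over $J\colon\mathcal C\to\mathcal D$, with $\mathcal D$ a 2-category, and $S$ a 2-monad on $\mathcal D$. A strict algebra in $\mathcal C$ is an object $A\in\mathcal C$ with a strict $S$-algebra structure on $JA$. A lifting of $T$ to strict $S$-algebras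 consists of: a strict algebra structure on $TA$ for every strict algebra $A$ in $\mathcal C$; a pseudomorphism structure on $f^*\colon TA\to TB$ for every pseudomorphism $f\colon JA\to TB$; and a pseudomorphism structure on $i_A\colon JA\to TA$ for every strict algebra $A$ in $\mathcal C$; such that $\alpha^*$ is an algebra 2-cell for every algebra 2-cell $\alpha\colon f\to g$ between pseudomorphisms $JA\to TB$, and $\mu_{g,f}$, $\eta_f$, $\theta_A$ are algebra 2-cells for all pseudomorphisms $f\colon JA\to TB$, $g\colon JB\to TC$ and all strict algebras $A$ in $\mathcal C$. **Limits.** Let $\mathcal L$ be one of: a chosen terminal object; chosen finite products (a chosen terminal object and chosen binary products); chosen finite limits (a chosen terminal object and chosen pullbacks). A 2-monad $S$ on $\mathbf{CAT}$ is the 2-monad for categories with $\mathcal L$ if the 2-category of strict $S$-algebras, strict morphisms and algebra 2-cells is isomorphic, over $\mathbf{CAT}$, to the 2-category of locally small categories with $\mathcal L$, functors that preserve the chosen limit diagrams strictly, and all natural transformations. **Theorem 7.1.** For each of the three choices of $\mathcal L$, the 2-monad for categories with $\mathcal L$ exists on $\mathbf{CAT}$, and for every such 2-monad $S$ the relative pseudomonad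 of presheaves $P$ over $J\colon\mathbf{Cat}\to\mathbf{CAT}$ has a lifting to strict $S$-algebras. -/

import Mathlib

open CategoryTheory
open scoped Bicategory

universe v w u w' v' u'

/-- A relative pseudomonad over a pseudofunctor `J : C ⥤ D` of bicategories. Composition of
1-cells is written in diagrammatic order, so `g^* ∘ f` is `f ≫ star.obj g`. -/
structure RelativePseudomonad {C : Type u} [Bicategory.{w, v} C] {D : Type u'}
    [Bicategory.{w', v'} D] (J : Pseudofunctor C D) where
  /-- the object `T X` -/
  obj : C → D
  /-- the functors `(-)^*` -/
  star : ∀ {X Y : C}, (J.obj X ⟶ obj Y) ⥤ (obj X ⟶ obj Y)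
  /-- the unit -/
  unit : ∀ X : C, J.obj X ⟶ obj X
  /-- the associativity 2-cells `(g^* f)^* ≅ g^* f^*` -/
  mu : ∀ {X Y Z : C} (f : J.obj X ⟶ obj Y) (g : J.obj Y ⟶ obj Z),
    star.obj (f ≫ star.obj g) ≅ star.obj f ≫ star.obj g
  /-- the right unit 2-cells `f ≅ f^* i` -/
  eta : ∀ {X Y : C} (f : J.obj X ⟶ obj Y), f ≅ unit X ≫ star.obj f
  /-- the left unit 2-cells `i^* ≅ 1` -/
  theta : ∀ X : C, star.obj (unit X) ≅ 𝟙 (obj X)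
  mu_natural : ∀ {X Y Z : C} {f f' : J.obj X ⟶ obj Y} {g g' : J.obj Y ⟶ obj Z}
    (α : f ⟶ f') (β : g ⟶ g'),
    star.map (α ▷ star.obj g ≫ f' ◁ star.map β) ≫ (mu f' g').hom =
      (mu f g).hom ≫ star.map α ▷ star.obj g ≫ star.obj f' ◁ star.map β
  eta_natural : ∀ {X Y : C} {f f' : J.obj X ⟶ obj Y} (α : f ⟶ f'),
    α ≫ (eta f').hom = (eta f).hom ≫ unit X ◁ star.map α
  assoc : ∀ {X Y Z V : C} (f : J.obj X ⟶ obj Y) (g : J.obj Y ⟶ obj Z) (h : J.obj Z ⟶ obj V),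
    star.map (f ◁ (mu g h).hom) ≫ star.map (α_ f (star.obj g) (star.obj h)).inv ≫
        (mu (f ≫ star.obj g) h).hom ≫ (mu f g).hom ▷ star.obj h =
      (mu f (g ≫ star.obj h)).hom ≫ star.obj f ◁ (mu g h).hom ≫
        (α_ (star.obj f) (star.obj g) (star.obj h)).inv
  unit_star : ∀ {X Y : C} (f : J.obj X ⟶ obj Y),
    star.map (eta f).hom ≫ (mu (unit X) f).hom ≫ (theta X).hom ▷ star.obj f =
      (λ_ (star.obj f)).inv

namespace RelativePseudomonad

open Bicategory

variable {C : Type u} [Bicategory.{w, v} C] {D : Type u'} [Bicategory.{w', v'} D]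

/-- `η : f ⟶ i ≫ f'` exhibits `f'` as a left extension of `f` along `i`, with respect to 1-cells
with the same codomain as `f`. -/
def IsLeftExt {X X' Y : D} (i : X ⟶ X') {f : X ⟶ Y} {f' : X' ⟶ Y} (η : f ⟶ i ≫ f') : Prop :=
  ∀ g : X' ⟶ Y, Function.Bijective fun β : f' ⟶ g => η ≫ i ◁ β

namespace IsLeftExt

variable {X X' Y : D} {i : X ⟶ X'} {f : X ⟶ Y} {f' : X' ⟶ Y} {η : f ⟶ i ≫ f'}

theorem hom_ext (H : IsLeftExt i η) {g : X' ⟶ Y} {β γ : f' ⟶ g}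
    (h : η ≫ i ◁ β = η ≫ i ◁ γ) : β = γ :=
  (H g).1 h

/-- The 2-cell induced by the universal property. -/
noncomputable def desc (H : IsLeftExt i η) {g : X' ⟶ Y} (ξ : f ⟶ i ≫ g) : f' ⟶ g :=
  ((H g).2 ξ).choose

theorem fac (H : IsLeftExt i η) {g : X' ⟶ Y} (ξ : f ⟶ i ≫ g) : η ≫ i ◁ H.desc ξ = ξ :=
  ((H g).2 ξ).choose_spec

theorem fac_assoc (H : IsLeftExt i η) {g : X' ⟶ Y} (ξ : f ⟶ i ≫ g) {k : X ⟶ Y}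
    (ζ : i ≫ g ⟶ k) : η ≫ i ◁ H.desc ξ ≫ ζ = ξ ≫ ζ := by
  rw [← Category.assoc, fac]

/-- Uniqueness of left extensions. -/
@[simps]
noncomputable def iso (H : IsLeftExt i η) {g : X' ⟶ Y} {ξ : f ⟶ i ≫ g} (H' : IsLeftExt i ξ) :
    f' ≅ g where
  hom := H.desc ξ
  inv := H'.desc η
  hom_inv_id := H.hom_ext (by
    rw [whiskerLeft_comp, fac_assoc, fac, whiskerLeft_id, Category.comp_id])
  inv_hom_id := H'.hom_ext (by
    rw [whiskerLeft_comp, fac_assoc, fac, whiskerLeft_id, Category.comp_id])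

end IsLeftExt

/-- The functor `(-)^*` determined by a choice of left extensions. -/
@[simps]
noncomputable def starOfLeftExt {X X' Y : D} (i : X ⟶ X') (st : (X ⟶ Y) → (X' ⟶ Y))
    (eta : ∀ f : X ⟶ Y, f ≅ i ≫ st f) (h_eta : ∀ f : X ⟶ Y, IsLeftExt i (eta f).hom) :
    (X ⟶ Y) ⥤ (X' ⟶ Y) where
  obj := st
  map {f g} α := (h_eta f).desc (α ≫ (eta g).hom)
  map_id f := (h_eta f).hom_ext (by simp [IsLeftExt.fac])
  map_comp {f g h} α β := (h_eta f).hom_ext (by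
    rw [whiskerLeft_comp, IsLeftExt.fac, IsLeftExt.fac_assoc, Category.assoc, Category.assoc,
      IsLeftExt.fac])

/-- The relative pseudomonad determined by left extensions that are stable under composition and
identities: the 2-cells `mu` and `theta` come from the universal property. -/
noncomputable def ofLeftExt (J : Pseudofunctor C D) (obj : C → D)
    (star : ∀ {X Y : C}, (J.obj X ⟶ obj Y) ⥤ (obj X ⟶ obj Y))
    (unit : ∀ X : C, J.obj X ⟶ obj X)
    (eta : ∀ {X Y : C} (f : J.obj X ⟶ obj Y), f ≅ unit X ≫ star.obj f)
    (eta_natural : ∀ {X Y : C} {f f' : J.obj X ⟶ obj Y} (α : f ⟶ f'),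
      α ≫ (eta f').hom = (eta f).hom ≫ unit X ◁ star.map α)
    (h_eta : ∀ {X Y : C} (f : J.obj X ⟶ obj Y), IsLeftExt (unit X) (eta f).hom)
    (h_comp : ∀ {X Y Z : C} (f : J.obj X ⟶ obj Y) (g : J.obj Y ⟶ obj Z),
      IsLeftExt (unit X) ((eta f).hom ▷ star.obj g ≫ (α_ _ _ _).hom))
    (h_id : ∀ X : C, IsLeftExt (unit X) (ρ_ (unit X)).inv) :
    RelativePseudomonad J where
  obj := obj
  star := star
  unit := unit
  mu f g := (h_eta _).iso (h_comp f g)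
  eta f := eta f
  theta X := (h_eta _).iso (h_id X)
  mu_natural {X Y Z f f' g g'} α β := (h_eta _).hom_ext (by
    simp only [whiskerLeft_comp, IsLeftExt.iso_hom, IsLeftExt.fac, IsLeftExt.fac_assoc,
      Category.assoc, ← reassoc_of% eta_natural, Functor.map_comp]
    rw [← associator_naturality_middle_assoc, ← associator_naturality_right,
      ← comp_whiskerRight_assoc, ← eta_natural, comp_whiskerRight_assoc,
      whisker_exchange_assoc])
  eta_natural := eta_natural
  assoc {X Y Z V} f g h := (h_eta _).hom_ext (by
    simp only [whiskerLeft_comp, IsLeftExt.iso_hom, IsLeftExt.fac_assoc, Category.assoc,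
      ← reassoc_of% eta_natural]
    rw [← associator_naturality_middle, ← associator_naturality_right_assoc,
      ← comp_whiskerRight_assoc, IsLeftExt.fac, comp_whiskerRight_assoc,
      ← whisker_exchange_assoc]
    congr 1
    simp)
  unit_star {X Y} f := (h_eta _).hom_ext (by
    simp only [whiskerLeft_comp, IsLeftExt.iso_hom, IsLeftExt.fac_assoc, Category.assoc,
      ← reassoc_of% eta_natural]
    rw [← associator_naturality_middle, ← comp_whiskerRight_assoc, IsLeftExt.fac]
    simp)

end RelativePseudomonad

/-! ### Presheaves -/

attribute [local instance] uliftCategory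

/-- The inclusion of the 2-category of small categories into the 2-category of locally small
categories. -/
def catInclusion : StrictPseudofunctor Cat.{v, v} Cat.{v, v + 1} :=
  StrictPseudofunctor.mk''
    { obj := fun X => Cat.of (ULift.{v + 1} X)
      map := fun F => (ULift.downFunctor ⋙ F.toFunctor ⋙ ULift.upFunctor).toCatHom
      map₂ := fun α =>
        (Functor.whiskerLeft ULift.downFunctor
          (Functor.whiskerRight α.toNatTrans ULift.upFunctor)).toCatHom₂
      map₂_id := fun _ => rfl
      map₂_comp := fun _ _ => rfl
      map_id := fun _ => rfl
      map_comp := fun _ _ => rfl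
      map₂_whisker_left := fun _ _ _ _ =>
        ((Category.id_comp _).trans (Category.comp_id _)).symm
      map₂_whisker_right := fun _ _ =>
        ((Category.id_comp _).trans (Category.comp_id _)).symm }

namespace PresheafPseudomonad

open Limits

section
variable {X : Type v} [SmallCategory X] {E : Type u} [Category.{v} E]

/-- Natural transformations out of a cocontinuous functor on presheaves are determined by their
restriction to representables. -/
theorem whiskerLeft_yoneda_bijective (L G : (Xᵒᵖ ⥤ Type v) ⥤ E)
    [HasColimitsOfSize.{v, v} E] [PreservesColimitsOfSize.{v, v} L] :
    Function.Bijective fun β : L ⟶ G => Functor.whiskerLeft (yoneda (C := X)) β := by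
  have h : Function.Bijective fun β : L ⟶ G =>
      Functor.whiskerLeft (uliftYoneda.{v} (C := X)) β := by
    have := Presheaf.isLeftKanExtension_of_preservesColimits.{v} L (Iso.refl _)
    have := (Functor.homEquivOfIsLeftKanExtension L (𝟙 (uliftYoneda.{v} (C := X) ⋙ L)) G).bijective
    convert this using 1
    ext β : 1
    simp [Functor.homEquivOfIsLeftKanExtension]
  let e := uliftYonedaIsoYoneda.{v} (C := X)
  let E : (uliftYoneda.{v} (C := X) ⋙ L ⟶ uliftYoneda.{v} (C := X) ⋙ G) ≃
      (yoneda ⋙ L ⟶ yoneda ⋙ G) :=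
    Iso.homCongr (Functor.isoWhiskerRight e L) (Functor.isoWhiskerRight e G)
  convert E.bijective.comp h using 1
  ext β Y : 4
  simp [E, Iso.homCongr]

variable [HasColimitsOfSize.{v, v} E]

theorem exists_cocontinuous (F : X ⥤ E) : ∃ (L : (Xᵒᵖ ⥤ Type v) ⥤ E) (_ : F ≅ yoneda ⋙ L),
    PreservesColimitsOfSize.{v, v} L :=
  ⟨uliftYoneda.{v}.leftKanExtension F,
    asIso (uliftYoneda.{v}.leftKanExtensionUnit F) ≪≫
      Functor.isoWhiskerRight uliftYonedaIsoYoneda.{v} _, inferInstance⟩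

theorem isLeftKanExtension (F : X ⥤ E) (L : (Xᵒᵖ ⥤ Type v) ⥤ E) (e : F ≅ yoneda ⋙ L)
    [PreservesColimitsOfSize.{v, v} L] : L.IsLeftKanExtension e.hom := by
  have h (T : (yoneda (C := X)).LeftExtension F) :
      ∃ β : L ⟶ T.right, e.hom ≫ Functor.whiskerLeft yoneda β = T.hom := by
    obtain ⟨β, hβ⟩ := (whiskerLeft_yoneda_bijective L T.right).2 (e.inv ≫ T.hom)
    exact ⟨β, (Iso.eq_inv_comp e).1 hβ⟩
  choose β hβ using h
  refine ⟨⟨Limits.IsInitial.ofUniqueHom (fun T => StructuredArrow.homMk (β T) (hβ T)) ?_⟩⟩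
  intro T m
  ext1
  apply (whiskerLeft_yoneda_bijective L T.right).1
  have h₁ : e.hom ≫ Functor.whiskerLeft yoneda m.right = T.hom := StructuredArrow.w m
  exact (Iso.cancel_iso_hom_left e _ _).1 (h₁.trans (hβ T).symm)

theorem exists_iso_leftKanExtension (F : X ⥤ E) :
    ∃ (L : (Xᵒᵖ ⥤ Type v) ⥤ E) (e : yoneda.leftKanExtension F ≅ L) (e' : F ≅ yoneda ⋙ L),
      PreservesColimitsOfSize.{v, v} L ∧
      yoneda.leftKanExtensionUnit F = e'.hom ≫ Functor.whiskerLeft yoneda e.inv := by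
  obtain ⟨L, e', h⟩ := exists_cocontinuous F
  have := isLeftKanExtension F L e'
  exact ⟨L, Functor.leftKanExtensionUnique _ (yoneda.leftKanExtensionUnit F) _ e'.hom, e', h,
    by simp⟩

instance (F : X ⥤ E) : IsIso (yoneda.leftKanExtensionUnit F) := by
  obtain ⟨L, e, e', h, he⟩ := exists_iso_leftKanExtension F
  rw [he]
  infer_instance

instance preservesColimits (F : X ⥤ E) :
    PreservesColimitsOfSize.{v, v} (yoneda.leftKanExtension F) := by
  obtain ⟨L, e, e', h, he⟩ := exists_iso_leftKanExtension F
  exact preservesColimits_of_natIso e.symm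

end

/-- The category of presheaves on a small category. -/
abbrev psh (X : Cat.{v, v}) : Cat.{v, v + 1} := Cat.of (Xᵒᵖ ⥤ Type v)

/-- The Yoneda embedding. -/
def unit (X : Cat.{v, v}) : catInclusion.obj X ⟶ psh X :=
  (ULift.downFunctor ⋙ yoneda (C := X)).toCatHom

/-- The functor on a small category underlying a 1-cell out of its image in the 2-category of
locally small categories. -/
def toFun {X Y : Cat.{v, v}} (F : catInclusion.obj X ⟶ psh Y) : X ⥤ Yᵒᵖ ⥤ Type v :=
  ULift.upFunctor ⋙ F.toFunctor

/-- The left Kan extension along the Yoneda embedding. -/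
noncomputable def lan {X Y : Cat.{v, v}} (F : catInclusion.obj X ⟶ psh Y) : psh X ⟶ psh Y :=
  (yoneda.leftKanExtension (toFun F)).toCatHom

instance {X Y : Cat.{v, v}} (F : catInclusion.obj X ⟶ psh Y) :
    PreservesColimitsOfSize.{v, v} (lan F).toFunctor :=
  preservesColimits (toFun F)

/-- The canonical isomorphism between a functor and the restriction to representables of its left
Kan extension along the Yoneda embedding. -/
noncomputable def eta {X Y : Cat.{v, v}} (F : catInclusion.obj X ⟶ psh Y) : F ≅ unit X ≫ lan F :=
  Cat.Hom.isoMk (Functor.isoWhiskerLeft ULift.downFunctor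
    (asIso (yoneda.leftKanExtensionUnit (toFun F))))

theorem isLeftExt {X Y : Cat.{v, v}} (F : catInclusion.obj X ⟶ psh Y) (L : psh X ⟶ psh Y)
    [hL : PreservesColimitsOfSize.{v, v} L.toFunctor] (e : F ≅ unit X ≫ L) :
    RelativePseudomonad.IsLeftExt (unit X) e.hom := by
  intro G
  have key (L G : (Xᵒᵖ ⥤ Type v) ⥤ Yᵒᵖ ⥤ Type v) [PreservesColimitsOfSize.{v, v} L] :=
    whiskerLeft_yoneda_bijective L G
  have hb := @key L.toFunctor G.toFunctor hL
  constructor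
  · intro β γ h
    have h' := (Iso.cancel_iso_hom_left e _ _).1 h
    refine Cat.Hom₂.ext (hb.1 ?_)
    ext x : 2
    exact congr_arg (fun t => t.toNatTrans.app (ULift.up x)) h'
  · intro ξ
    obtain ⟨β, hβ⟩ := hb.2 (Functor.whiskerLeft ULift.upFunctor (e.inv ≫ ξ).toNatTrans)
    refine ⟨⟨β⟩, ?_⟩
    rw [← Iso.eq_inv_comp]
    ext x : 3
    exact congr_arg (fun t => t.app x.down) hβ

end PresheafPseudomonad

open PresheafPseudomonad RelativePseudomonad in
/-- The relative pseudomonad of presheaves. -/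
noncomputable def presheafPseudomonad :
    RelativePseudomonad catInclusion.{v}.toPseudofunctor :=
  RelativePseudomonad.ofLeftExt _ psh
    (fun {X _} => starOfLeftExt (unit X) lan eta fun F => isLeftExt F (lan F) (eta F))
    unit eta (fun {_ _ f f'} α => ((isLeftExt f (lan f) (eta f)).fac (α ≫ (eta f').hom)).symm)
    (fun F => isLeftExt F (lan F) (eta F))
    (fun {X Y Z} F G => by
      have : Limits.PreservesColimitsOfSize.{v, v} (lan F ≫ lan G).toFunctor :=
        inferInstanceAs (Limits.PreservesColimitsOfSize.{v, v}
          ((lan F).toFunctor ⋙ (lan G).toFunctor))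
      exact isLeftExt (F ≫ lan G) (lan F ≫ lan G)
        (Bicategory.whiskerRightIso (eta F) (lan G) ≪≫ α_ _ _ _))
    (fun X => by
      have : Limits.PreservesColimitsOfSize.{v, v} (𝟙 (psh X) : psh X ⟶ psh X).toFunctor :=
        inferInstanceAs (Limits.PreservesColimitsOfSize.{v, v} (𝟭 _))
      exact isLeftExt (unit X) (𝟙 _) (ρ_ (unit X)).symm)

/-! ### 2-monads, strict algebras, pseudomorphisms -/

/-- A 2-monad on a strict 2-category: a 2-functor with 2-natural multiplication and unit satisfying
the monad axioms strictly. -/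
structure TwoMonad (D : Type u) [Bicategory.{w, v} D] [Bicategory.Strict D] where
  /-- the underlying 2-functor -/
  functor : StrictPseudofunctor D D
  /-- the unit -/
  e : ∀ A : D, A ⟶ functor.obj A
  /-- the multiplication -/
  m : ∀ A : D, functor.obj (functor.obj A) ⟶ functor.obj A
  e_natural : ∀ {A B : D} (f : A ⟶ B), f ≫ e B = e A ≫ functor.map f
  e_natural₂ : ∀ {A B : D} {f g : A ⟶ B} (α : f ⟶ g),
    α ▷ e B ≫ eqToHom (e_natural g) = eqToHom (e_natural f) ≫ e A ◁ functor.map₂ α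
  m_natural : ∀ {A B : D} (f : A ⟶ B),
    functor.map (functor.map f) ≫ m B = m A ≫ functor.map f
  m_natural₂ : ∀ {A B : D} {f g : A ⟶ B} (α : f ⟶ g),
    functor.map₂ (functor.map₂ α) ▷ m B ≫ eqToHom (m_natural g) =
      eqToHom (m_natural f) ≫ m A ◁ functor.map₂ α
  e_m : ∀ A : D, e (functor.obj A) ≫ m A = 𝟙 (functor.obj A)
  map_e_m : ∀ A : D, functor.map (e A) ≫ m A = 𝟙 (functor.obj A)
  m_m : ∀ A : D, m (functor.obj A) ≫ m A = functor.map (m A) ≫ m A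

namespace TwoMonad

variable {D : Type u} [Bicategory.{w, v} D] [Bicategory.Strict D] (S : TwoMonad D)

/-- A strict algebra structure on an object. -/
@[ext]
structure Alg (A : D) where
  /-- the structure map -/
  str : S.functor.obj A ⟶ A
  e_str : S.e A ≫ str = 𝟙 A
  m_str : S.m A ≫ str = S.functor.map str ≫ str

variable {S}

/-- `f` is a strict morphism of strict algebras. -/
def IsStrictHom {A B : D} (a : S.Alg A) (b : S.Alg B) (f : A ⟶ B) : Prop :=
  S.functor.map f ≫ b.str = a.str ≫ f

/-- A pseudomorphism structure on `f`: an invertible 2-cell compatible with the multiplication and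
the unit. -/
structure PseudoHom {A B : D} (a : S.Alg A) (b : S.Alg B) (f : A ⟶ B) where
  /-- the invertible 2-cell -/
  cell : S.functor.map f ≫ b.str ≅ a.str ≫ f
  e_cell : S.e A ◁ cell.hom = eqToHom (by
    rw [← Bicategory.Strict.assoc, ← Bicategory.Strict.assoc, ← S.e_natural, a.e_str,
      Bicategory.Strict.assoc, b.e_str, Bicategory.Strict.comp_id, Bicategory.Strict.id_comp])
  m_cell : eqToHom (by
        rw [S.functor.map_comp, Bicategory.Strict.assoc, ← b.m_str, ← Bicategory.Strict.assoc,
          ← Bicategory.Strict.assoc, S.m_natural]) ≫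
      S.m A ◁ cell.hom ≫
      eqToHom (by rw [← Bicategory.Strict.assoc, ← Bicategory.Strict.assoc, a.m_str]) =
    S.functor.map₂ cell.hom ▷ b.str ≫
      eqToHom (by rw [S.functor.map_comp, Bicategory.Strict.assoc]) ≫
      S.functor.map a.str ◁ cell.hom

/-- The compatibility of a 2-cell with pseudomorphism structures on its domain and codomain: it is
an algebra 2-cell. -/
def IsAlgTwoCell {A B : D} {a : S.Alg A} {b : S.Alg B} {f g : A ⟶ B} (φ : PseudoHom a b f)
    (ψ : PseudoHom a b g) (α : f ⟶ g) : Prop :=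
  S.functor.map₂ α ▷ b.str ≫ ψ.cell.hom = φ.cell.hom ≫ a.str ◁ α

/-- A strict morphism as a pseudomorphism. -/
def IsStrictHom.toPseudoHom {A B : D} {a : S.Alg A} {b : S.Alg B} {f : A ⟶ B}
    (h : IsStrictHom a b f) : PseudoHom a b f where
  cell := eqToIso (show S.functor.map f ≫ b.str = a.str ≫ f from h)
  e_cell := by simp
  m_cell := by simp [PrelaxFunctor.map₂_eqToHom]

theorem IsStrictHom.id {A : D} (a : S.Alg A) : IsStrictHom a a (𝟙 A) := by
  rw [IsStrictHom, S.functor.map_id, Bicategory.Strict.id_comp, Bicategory.Strict.comp_id]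

/-- The identity pseudomorphism. -/
def PseudoHom.id {A : D} (a : S.Alg A) : PseudoHom a a (𝟙 A) :=
  (IsStrictHom.id a).toPseudoHom

section strict

open Bicategory

variable {A B C E : D}

theorem whisker_whisker (f : A ⟶ B) (g : B ⟶ C) {h k : C ⟶ E} (α : h ⟶ k) :
    f ◁ g ◁ α = eqToHom (Strict.assoc _ _ _).symm ≫ (f ≫ g) ◁ α ≫ eqToHom (Strict.assoc _ _ _) := by
  simp [Strict.associator_eqToIso]

theorem comp_whisker (f : A ⟶ B) (g : B ⟶ C) {h k : C ⟶ E} (α : h ⟶ k) :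
    (f ≫ g) ◁ α = eqToHom (Strict.assoc _ _ _) ≫ f ◁ g ◁ α ≫ eqToHom (Strict.assoc _ _ _).symm := by
  simp [Strict.associator_eqToIso]

theorem whisker_left_right (f : A ⟶ B) {g h : B ⟶ C} (α : g ⟶ h) (k : C ⟶ E) :
    f ◁ (α ▷ k) = eqToHom (Strict.assoc _ _ _).symm ≫ (f ◁ α) ▷ k ≫ eqToHom (Strict.assoc _ _ _) := by
  simp [Strict.associator_eqToIso]

theorem whisker_right_right {f g : A ⟶ B} (α : f ⟶ g) (h : B ⟶ C) (k : C ⟶ E) :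
    α ▷ h ▷ k = eqToHom (Strict.assoc _ _ _) ≫ α ▷ (h ≫ k) ≫ eqToHom (Strict.assoc _ _ _).symm := by
  simp [Strict.associator_eqToIso]

theorem map₂_left (f : A ⟶ B) {g h : B ⟶ C} (α : g ⟶ h) :
    S.functor.map₂ (f ◁ α) = eqToHom (S.functor.map_comp _ _) ≫
      S.functor.map f ◁ S.functor.map₂ α ≫ eqToHom (S.functor.map_comp _ _).symm := by
  simp [S.functor.mapComp_eq_eqToIso]

theorem map₂_right {f g : A ⟶ B} (α : f ⟶ g) (h : B ⟶ C) :
    S.functor.map₂ (α ▷ h) = eqToHom (S.functor.map_comp _ _) ≫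
      S.functor.map₂ α ▷ S.functor.map h ≫ eqToHom (S.functor.map_comp _ _).symm := by
  simp [S.functor.mapComp_eq_eqToIso]

end strict

/-- The composite of two pseudomorphisms. -/
def PseudoHom.comp {A B C : D} {a : S.Alg A} {b : S.Alg B} {c : S.Alg C} {f : A ⟶ B} {g : B ⟶ C}
    (φ : PseudoHom a b f) (ψ : PseudoHom b c g) : PseudoHom a c (f ≫ g) where
  cell := eqToIso (by rw [S.functor.map_comp, Bicategory.Strict.assoc]) ≪≫
    Bicategory.whiskerLeftIso (S.functor.map f) ψ.cell ≪≫
    eqToIso (Bicategory.Strict.assoc _ _ _).symm ≪≫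
    Bicategory.whiskerRightIso φ.cell g ≪≫ eqToIso (Bicategory.Strict.assoc _ _ _)
  e_cell := by
    simp only [Iso.trans_hom, eqToIso.hom, Bicategory.whiskerLeftIso_hom,
      Bicategory.whiskerRightIso_hom, Bicategory.whiskerLeft_comp, Bicategory.whiskerLeft_eqToHom,
      whisker_whisker, whisker_left_right, φ.e_cell, Bicategory.eqToHom_whiskerRight,
      Category.assoc, eqToHom_trans, eqToHom_trans_assoc]
    rw [Bicategory.congr_whiskerLeft (S.e_natural f).symm, comp_whisker, ψ.e_cell]
    simp only [Bicategory.whiskerLeft_eqToHom, eqToHom_trans]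
  m_cell := by
    have h₁ := congr_arg (S.functor.map (S.functor.map f) ◁ ·) ψ.m_cell
    have h₂ := congr_arg (· ▷ g) φ.m_cell
    have h₃ := Bicategory.whisker_exchange (S.functor.map₂ φ.cell.hom) ψ.cell.hom
    simp only [Bicategory.whiskerLeft_comp, Bicategory.whiskerLeft_eqToHom,
      whisker_whisker, whisker_left_right, Bicategory.comp_whiskerRight, whisker_right_right,
      Category.assoc, eqToHom_trans, eqToHom_trans_assoc, Bicategory.eqToHom_whiskerRight] at h₁ h₂
    simp only [Iso.trans_hom, eqToIso.hom, Bicategory.whiskerLeftIso_hom,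
      Bicategory.whiskerRightIso_hom, Bicategory.whiskerLeft_comp, Bicategory.whiskerLeft_eqToHom,
      whisker_whisker, whisker_left_right, whisker_right_right,
      PrelaxFunctor.map₂_comp, map₂_left, map₂_right,
      PrelaxFunctor.map₂_eqToHom, Bicategory.comp_whiskerRight,
      Category.assoc, eqToHom_trans, eqToHom_trans_assoc, Bicategory.eqToHom_whiskerRight]
    rw [eqToHom_comp_iff, comp_eqToHom_iff] at h₁ h₂
    rw [Bicategory.congr_whiskerLeft (S.m_natural f).symm, h₁, h₂,
      Bicategory.congr_whiskerLeft (S.functor.map_comp (S.functor.map f) b.str).symm,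
      Bicategory.congr_whiskerLeft (S.functor.map_comp a.str f).symm]
    simp only [Category.assoc, eqToHom_trans, eqToHom_trans_assoc, eqToHom_refl,
      Category.id_comp, reassoc_of% h₃]

end TwoMonad
/-- A lifting of a relative pseudomonad `T` over `J : C ⥤ D` to strict algebras for a 2-monad `S` on
`D`. A strict algebra in `C` is an object `X` of `C` with a strict `S`-algebra structure on
`J X`. -/
structure StrictLifting {C : Type u} [Bicategory.{w, v} C] {D : Type u'} [Bicategory.{w', v'} D]
    [Bicategory.Strict D] {J : Pseudofunctor C D} (T : RelativePseudomonad J)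
    (S : TwoMonad D) where
  /-- a strict algebra structure on `T A` for every strict algebra `A` -/
  alg : ∀ {X : C}, S.Alg (J.obj X) → S.Alg (T.obj X)
  /-- a pseudomorphism structure on `f^*` for every pseudomorphism `f : J A ⟶ T B` -/
  star : ∀ {X Y : C} {a : S.Alg (J.obj X)} {b : S.Alg (J.obj Y)} {f : J.obj X ⟶ T.obj Y},
    TwoMonad.PseudoHom a (alg b) f → TwoMonad.PseudoHom (alg a) (alg b) (T.star.obj f)
  /-- a pseudomorphism structure on the unit `J A ⟶ T A` for every strict algebra `A` -/
  unit : ∀ {X : C} (a : S.Alg (J.obj X)), TwoMonad.PseudoHom a (alg a) (T.unit X)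
  star_map : ∀ {X Y : C} {a : S.Alg (J.obj X)} {b : S.Alg (J.obj Y)} {f g : J.obj X ⟶ T.obj Y}
    (φ : TwoMonad.PseudoHom a (alg b) f) (ψ : TwoMonad.PseudoHom a (alg b) g) (α : f ⟶ g),
    TwoMonad.IsAlgTwoCell φ ψ α → TwoMonad.IsAlgTwoCell (star φ) (star ψ) (T.star.map α)
  mu : ∀ {X Y Z : C} {a : S.Alg (J.obj X)} {b : S.Alg (J.obj Y)} {c : S.Alg (J.obj Z)}
    {f : J.obj X ⟶ T.obj Y} {g : J.obj Y ⟶ T.obj Z}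
    (φ : TwoMonad.PseudoHom a (alg b) f) (ψ : TwoMonad.PseudoHom b (alg c) g),
    TwoMonad.IsAlgTwoCell (star (φ.comp (star ψ))) ((star φ).comp (star ψ)) (T.mu f g).hom
  eta : ∀ {X Y : C} {a : S.Alg (J.obj X)} {b : S.Alg (J.obj Y)} {f : J.obj X ⟶ T.obj Y}
    (φ : TwoMonad.PseudoHom a (alg b) f),
    TwoMonad.IsAlgTwoCell φ ((unit a).comp (star φ)) (T.eta f).hom
  theta : ∀ {X : C} (a : S.Alg (J.obj X)),
    TwoMonad.IsAlgTwoCell (star (unit a)) (TwoMonad.PseudoHom.id (alg a)) (T.theta X).hom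

/-! ### Categories with chosen limits -/

/-- A choice of a terminal object. -/
structure ChosenTerminal (A : Type u) [Category.{v} A] where
  /-- the chosen terminal object -/
  top : A
  isTerminal : Nonempty (Limits.IsTerminal top)

/-- A choice of finite products: a terminal object and binary products. -/
structure ChosenFiniteProducts (A : Type u) [Category.{v} A] extends ChosenTerminal A where
  /-- the chosen product -/
  prod : A → A → A
  /-- the first projection -/
  fst : ∀ X Y : A, prod X Y ⟶ X
  /-- the second projection -/
  snd : ∀ X Y : A, prod X Y ⟶ Y
  isLimit : ∀ X Y : A, Nonempty (Limits.IsLimit (Limits.BinaryFan.mk (fst X Y) (snd X Y)))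

/-- A choice of finite limits: a terminal object and pullbacks. -/
structure ChosenFiniteLimits (A : Type u) [Category.{v} A] extends ChosenTerminal A where
  /-- the chosen pullback -/
  pullback : ∀ {X Y Z : A}, (X ⟶ Z) → (Y ⟶ Z) → A
  /-- the first projection -/
  fst : ∀ {X Y Z : A} (f : X ⟶ Z) (g : Y ⟶ Z), pullback f g ⟶ X
  /-- the second projection -/
  snd : ∀ {X Y Z : A} (f : X ⟶ Z) (g : Y ⟶ Z), pullback f g ⟶ Y
  isPullback : ∀ {X Y Z : A} (f : X ⟶ Z) (g : Y ⟶ Z), IsPullback (fst f g) (snd f g) f g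

section
variable {A B : Type u} [Category.{v} A] [Category.{v} B]

/-- The functor `F` sends the chosen terminal object to the chosen terminal object. -/
def ChosenTerminal.StrictlyPreserved (a : ChosenTerminal A) (b : ChosenTerminal B) (F : A ⥤ B) :
    Prop :=
  F.obj a.top = b.top

/-- The functor `F` sends the chosen terminal object and the chosen product diagrams to the chosen
ones. -/
def ChosenFiniteProducts.StrictlyPreserved (a : ChosenFiniteProducts A)
    (b : ChosenFiniteProducts B) (F : A ⥤ B) : Prop :=
  a.toChosenTerminal.StrictlyPreserved b.toChosenTerminal F ∧
    ∀ X Y : A, ∃ h : F.obj (a.prod X Y) = b.prod (F.obj X) (F.obj Y),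
      F.map (a.fst X Y) = eqToHom h ≫ b.fst (F.obj X) (F.obj Y) ∧
      F.map (a.snd X Y) = eqToHom h ≫ b.snd (F.obj X) (F.obj Y)

/-- The functor `F` sends the chosen terminal object and the chosen pullback diagrams to the chosen
ones. -/
def ChosenFiniteLimits.StrictlyPreserved (a : ChosenFiniteLimits A)
    (b : ChosenFiniteLimits B) (F : A ⥤ B) : Prop :=
  a.toChosenTerminal.StrictlyPreserved b.toChosenTerminal F ∧
    ∀ {X Y Z : A} (f : X ⟶ Z) (g : Y ⟶ Z),
      ∃ h : F.obj (a.pullback f g) = b.pullback (F.map f) (F.map g),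
        F.map (a.fst f g) = eqToHom h ≫ b.fst (F.map f) (F.map g) ∧
        F.map (a.snd f g) = eqToHom h ≫ b.snd (F.map f) (F.map g)

end

/-- The three classes of limits under consideration. -/
inductive LimitKind
  | terminal
  | finiteProducts
  | finiteLimits

namespace LimitKind

/-- A choice of limits of the given kind in a locally small category. -/
def Chosen (K : LimitKind) (A : Cat.{v, v + 1}) : Type (v + 1) :=
  match K with
  | terminal => ChosenTerminal A
  | finiteProducts => ChosenFiniteProducts A
  | finiteLimits => ChosenFiniteLimits A

/-- Strict preservation of the chosen limits by a functor. -/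
def StrictlyPreserved (K : LimitKind) {A B : Cat.{v, v + 1}} (a : K.Chosen A) (b : K.Chosen B)
    (F : A ⟶ B) : Prop :=
  match K, a, b with
  | terminal, a, b => ChosenTerminal.StrictlyPreserved a b F.toFunctor
  | finiteProducts, a, b => ChosenFiniteProducts.StrictlyPreserved a b F.toFunctor
  | finiteLimits, a, b => ChosenFiniteLimits.StrictlyPreserved a b F.toFunctor

end LimitKind

/-- `S` is the 2-monad for categories with chosen limits of kind `K`: the 2-category of strict
`S`-algebras, strict morphisms and algebra 2-cells is isomorphic, over the 2-category of locally
small categories, to the 2-category of categories with chosen limits of kind `K`, functors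
preserving the chosen limits strictly, and all natural transformations. -/
def TwoMonad.IsMonadFor (S : TwoMonad Cat.{v, v + 1}) (K : LimitKind) : Prop :=
  ∃ φ : ∀ A : Cat.{v, v + 1}, S.Alg A ≃ K.Chosen A,
    (∀ {A B : Cat.{v, v + 1}} (a : S.Alg A) (b : S.Alg B) (f : A ⟶ B),
      TwoMonad.IsStrictHom a b f ↔ K.StrictlyPreserved (φ A a) (φ B b) f) ∧
    ∀ {A B : Cat.{v, v + 1}} (a : S.Alg A) (b : S.Alg B) (f g : A ⟶ B)
      (hf : TwoMonad.IsStrictHom a b f) (hg : TwoMonad.IsStrictHom a b g) (α : f ⟶ g),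
      TwoMonad.IsAlgTwoCell hf.toPseudoHom hg.toPseudoHom α

/-! For these 2-monads, algebra structure on functors is a property. Fix a family `J` of shapes. If
strict `S`-algebras are choices of limits of shapes `J`, then the free algebra `S A` satisfies a
two-dimensional universal property: for a limit-preserving `h` and an arbitrary `g`, restriction
along the unit is a bijection from 2-cells `g ⟶ h` out of `S A` to 2-cells out of `A`
(`whiskerLeft_incl_bijective`, `LimitAlgebras.bijective`). Hence a functor between algebras carries
a pseudomorphism structure exactly when it preserves the limits, and every natural transformation
between pseudomorphisms is an algebra 2-cell. All coherence conditions of a lifting then hold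
automatically. It remains to see that presheaf categories have the limits, that the Yoneda embedding
preserves them, and that the left Kan extension of a limit-preserving functor preserves them.

Existence of `S` needs a free category with chosen limits satisfying a strict universal property.
Its objects are formal iterated limits of objects of `A`, and its morphisms are those of their
interpretations in the opposite of the category of copresheaves on `A`. A functor `F : A ⥤ B` into a
category with chosen limits extends by recursion on formal limits: the value at a formal limit is a
universal arrow from `b ↦ Hom(b, F -)` to its interpretation. The resulting 2-monad is
colax-idempotent: the structure map of an algebra is right adjoint to the unit, so it preserves
limits. This identifies algebras with choices of limits. The free objects of any other 2-monad with
the same algebras and strict morphisms are isomorphic to these under `A`, and so inherit the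
two-dimensional property.

For Kan extensions along Yoneda, the terminal case is direct: the terminal presheaf is
representable. In the other two cases the evaluation at `y` of a cocontinuous `L` is a colimit over
the opposite of the category of elements of `g = yoneda ⋙ L ⋙ ev_y`. If `g` preserves finite
products this index category is sifted; if `g` preserves finite limits it is filtered. The colimit
commutes with the limits in question. -/

section

universe u₁

open Limits Opposite

/-! ### Chosen limits of given shapes -/

/-- A choice of limit cones for all diagrams with shapes in the family `J`. -/
structure ChosenLimits {ι : Type} (J : ι → Type) [∀ i, SmallCategory (J i)] (A : Type u)
    [Category.{v} A] where
  /-- the chosen cone -/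
  cone : ∀ i (D : J i ⥤ A), Cone D
  isLimit : ∀ i (D : J i ⥤ A), Nonempty (IsLimit (cone i D))

/-- The functor `F` preserves all limits with shapes in the family `J`. -/
def PreservesShapes {ι : Type} (J : ι → Type) [∀ i, SmallCategory (J i)] {A : Type u}
    [Category.{v} A] {B : Type u'} [Category.{v'} B] (F : A ⥤ B) : Prop :=
  ∀ i, PreservesLimitsOfShape (J i) F

section
variable {ι : Type} {J : ι → Type} [∀ i, SmallCategory (J i)]

namespace PreservesShapes
variable {A : Type u} [Category.{v} A] {B : Type u'} [Category.{v'} B] {E : Type w} [Category.{w'} E]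

theorem comp {F : A ⥤ B} {G : B ⥤ E} (hF : PreservesShapes J F) (hG : PreservesShapes J G) :
    PreservesShapes J (F ⋙ G) := fun i =>
  have := hF i
  have := hG i
  inferInstance

theorem of_iso {F G : A ⥤ B} (e : F ≅ G) (hF : PreservesShapes J F) : PreservesShapes J G :=
  fun i =>
    have := hF i
    preservesLimitsOfShape_of_natIso e

theorem of_isEquivalence (F : A ⥤ B) [F.IsEquivalence] : PreservesShapes J F :=
  fun _ => inferInstance

end PreservesShapes

namespace ChosenLimits
variable {A : Type u} [Category.{v} A] {B : Type u'} [Category.{v'} B] {E : Type w} [Category.{w'} E]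

/-- The functor `F` sends the chosen limit cones to the chosen ones. -/
def StrictlyPreserved (a : ChosenLimits J A) (b : ChosenLimits J B) (F : A ⥤ B) : Prop :=
  ∀ i (D : J i ⥤ A), F.mapCone (a.cone i D) = b.cone i (D ⋙ F)

theorem ext' {a b : ChosenLimits J A} (h : ∀ i D, a.cone i D = b.cone i D) : a = b := by
  cases a; cases b
  congr
  funext i D
  exact h i D

theorem StrictlyPreserved.id (a : ChosenLimits J A) : a.StrictlyPreserved a (𝟭 A) :=
  fun _ _ => rfl

theorem StrictlyPreserved.comp {a : ChosenLimits J A} {b : ChosenLimits J B}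
    {c : ChosenLimits J E} {F : A ⥤ B} {G : B ⥤ E} (hF : a.StrictlyPreserved b F)
    (hG : b.StrictlyPreserved c G) : a.StrictlyPreserved c (F ⋙ G) := fun i D =>
  (congr_arg G.mapCone (hF i D)).trans (hG i (D ⋙ F))

theorem StrictlyPreserved.preservesShapes {a : ChosenLimits J A} {b : ChosenLimits J B} {F : A ⥤ B}
    (h : a.StrictlyPreserved b F) : PreservesShapes J F := fun i =>
  ⟨fun {D} => preservesLimit_of_preserves_limit_cone (a.isLimit i D).some
    (by rw [h i D]; exact (b.isLimit i _).some)⟩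

end ChosenLimits

/-! ### Universal arrows -/

section
variable {B : Type u} [Category.{v} B] {M : Type u'} [Category.{v'} M]

/-- `τ` is a universal arrow from the functor `N` to the object `X`. -/
def IsUniversalArrow (N : B ⥤ M) {q : B} {X : M} (τ : N.obj q ⟶ X) : Prop :=
  ∀ b : B, Function.Bijective fun f : b ⟶ q => N.map f ≫ τ

namespace IsUniversalArrow
variable {N : B ⥤ M} {q : B} {X : M} {τ : N.obj q ⟶ X}

/-- The factorisation through a universal arrow. -/
noncomputable def lift (h : IsUniversalArrow N τ) {b : B} (σ : N.obj b ⟶ X) : b ⟶ q :=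
  ((h b).2 σ).choose

theorem fac (h : IsUniversalArrow N τ) {b : B} (σ : N.obj b ⟶ X) : N.map (h.lift σ) ≫ τ = σ :=
  ((h b).2 σ).choose_spec

theorem hom_ext (h : IsUniversalArrow N τ) {b : B} {f g : b ⟶ q}
    (w : N.map f ≫ τ = N.map g ≫ τ) : f = g :=
  (h b).1 w

theorem lift_eq (h : IsUniversalArrow N τ) {b : B} {σ : N.obj b ⟶ X} {f : b ⟶ q}
    (w : N.map f ≫ τ = σ) : h.lift σ = f :=
  h.hom_ext ((h.fac σ).trans w.symm)

theorem limit {K : Type*} [Category* K] {Q : K ⥤ B} {D : K ⥤ M} (κ : Q ⋙ N ⟶ D)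
    (h : ∀ k, IsUniversalArrow N (κ.app k)) {c : Cone Q} (hc : IsLimit c) {d : Cone D}
    (hd : IsLimit d) {τ : N.obj c.pt ⟶ d.pt}
    (hτ : ∀ k, τ ≫ d.π.app k = N.map (c.π.app k) ≫ κ.app k) : IsUniversalArrow N τ := by
  intro b
  constructor
  · intro f g w
    apply hc.hom_ext
    intro k
    apply (h k).hom_ext
    simp only [Functor.map_comp, Category.assoc, ← hτ]
    exact congr_arg (· ≫ d.π.app k) w |>.trans (Category.assoc _ _ _) |>.symm.trans
      (Category.assoc _ _ _) |>.symm
  · intro σ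
    let s : Cone Q := {
      pt := b
      π := { app k := (h k).lift (σ ≫ d.π.app k)
             naturality k l u := by
              apply (h l).hom_ext
              have := κ.naturality u
              dsimp at this ⊢
              rw [Category.id_comp, Functor.map_comp, Category.assoc, this, fac, ← Category.assoc,
                fac, Category.assoc, d.w] } }
    refine ⟨hc.lift s, hd.hom_ext fun k => ?_⟩
    dsimp only
    rw [Category.assoc, hτ, ← Category.assoc, ← Functor.map_comp, hc.fac]
    exact (h k).fac _

end IsUniversalArrow

/-- An object together with a universal arrow to `X`. -/
structure Realization (N : B ⥤ M) (X : M) where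
  /-- the object -/
  pt : B
  /-- the universal arrow -/
  hom : N.obj pt ⟶ X
  univ : IsUniversalArrow N hom

namespace Realization
variable {N : B ⥤ M}

/-- The functoriality of realizations. -/
noncomputable def map {X Y : M} (r : Realization N X) (s : Realization N Y) (f : X ⟶ Y) :
    r.pt ⟶ s.pt :=
  s.univ.lift (r.hom ≫ f)

theorem map_hom {X Y : M} (r : Realization N X) (s : Realization N Y) (f : X ⟶ Y) :
    N.map (r.map s f) ≫ s.hom = r.hom ≫ f :=
  s.univ.fac _

theorem map_id {X : M} (r : Realization N X) : r.map r (𝟙 X) = 𝟙 r.pt :=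
  r.univ.lift_eq (by simp)

theorem map_comp {X Y Z : M} (r : Realization N X) (s : Realization N Y) (t : Realization N Z)
    (f : X ⟶ Y) (g : Y ⟶ Z) : r.map t (f ≫ g) = r.map s f ≫ s.map t g :=
  t.univ.lift_eq (by
    rw [Functor.map_comp, Category.assoc, map_hom, ← Category.assoc, map_hom, Category.assoc])

/-- The diagram of realizations of the objects of a diagram. -/
noncomputable def diagram {K : Type*} [Category* K] (D : K ⥤ M)
    (r : ∀ k, Realization N (D.obj k)) : K ⥤ B where
  obj k := (r k).pt
  map {k l} u := (r k).map (r l) (D.map u)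
  map_id k := by rw [D.map_id, map_id]
  map_comp u w := by rw [D.map_comp, map_comp]

/-- The cone over `D` induced by a cone over the diagram of realizations. -/
noncomputable def diagramCone {K : Type*} [Category* K] (D : K ⥤ M)
    (r : ∀ k, Realization N (D.obj k)) (c : Cone (diagram D r)) : Cone D where
  pt := N.obj c.pt
  π := { app k := N.map (c.π.app k) ≫ (r k).hom
         naturality k l u := by
          have h {q : B} (p : q ⟶ (r k).pt) (p' : q ⟶ (r l).pt)
              (w : p ≫ (r k).map (r l) (D.map u) = p') :
              N.map p' ≫ (r l).hom = (N.map p ≫ (r k).hom) ≫ D.map u := by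
            rw [← w, Functor.map_comp, Category.assoc, map_hom, Category.assoc]
          exact (Category.id_comp _).trans (h _ _ (c.w u)) }

/-- Limits of realizable objects are realizable. -/
noncomputable def limit {K : Type*} [Category* K] (D : K ⥤ M) (r : ∀ k, Realization N (D.obj k))
    (c : Cone (diagram D r)) (hc : Nonempty (IsLimit c)) (d : Cone D) (hd : IsLimit d) :
    Realization N d.pt where
  pt := c.pt
  hom := hd.lift (diagramCone D r c)
  univ := IsUniversalArrow.limit (κ := { app k := (r k).hom, naturality _ _ _ := map_hom _ _ _ })
    (fun k => (r k).univ) hc.some hd (fun k => hd.fac _ k)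

end Realization

end

/-! ### The free category with chosen limits -/

section
variable {A : Type (v + 1)} [Category.{v} A]

variable (J A) in
/-- Formal limits of objects of `A`, together with their interpretation in the opposite of the
category of copresheaves. -/
inductive LimitTerm : (A ⥤ Type v)ᵒᵖ → Type (v + 1)
  | of (a : A) : LimitTerm (op (coyoneda.obj (op a)))
  -- The diagram lives among the interpretations, not among the terms. This makes the type an
  -- ordinary indexed family: morphisms between terms need not be defined simultaneously with the
  -- terms.
  | lim (i : ι) (D : J i ⥤ (A ⥤ Type v)ᵒᵖ) (t : ∀ k, LimitTerm (D.obj k)) : LimitTerm (limit D)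

/-- As `A` is large, morphisms of copresheaves form large sets in general. Into a generator they are
elements of a small set by Yoneda; into a limit they are determined by their composites with a small
family of projections. -/
theorem LimitTerm.small (X : (A ⥤ Type v)ᵒᵖ) {Y : (A ⥤ Type v)ᵒᵖ} (t : LimitTerm J A Y) :
    Small.{v} (X ⟶ Y) := by
  induction t with
  | of a =>
    exact small_of_injective (β := X.unop.obj a)
      (f := fun f => (coyonedaEquiv (f.unop : coyoneda.obj (op a) ⟶ X.unop)))
      (fun f g h => Quiver.Hom.unop_inj (coyonedaEquiv.injective h))
  | lim i D t ih =>
    exact small_of_injective (β := ∀ k, X ⟶ D.obj k) (f := fun f k => f ≫ limit.π D k)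
      (fun f g h => limit.hom_ext fun k => congr_fun h k)

variable (J A) in
/-- The objects of the free category with chosen limits on `A`. -/
structure FreeLimits where
  /-- the interpretation as a copresheaf -/
  val : (A ⥤ Type v)ᵒᵖ
  /-- the formal limit -/
  term : LimitTerm J A val

namespace FreeLimits

instance (X : (A ⥤ Type v)ᵒᵖ) (Y : FreeLimits J A) : Small.{v} (X ⟶ Y.val) := Y.term.small X

/-- Shrinking the hom-sets makes the free category locally small, hence an object of the same
2-category as `A`. -/
noncomputable instance : Category.{v} (FreeLimits J A) where
  Hom X Y := Shrink.{v} (X.val ⟶ Y.val)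
  id X := equivShrink _ (𝟙 X.val)
  comp f g := equivShrink _ ((equivShrink _).symm f ≫ (equivShrink _).symm g)

variable (J A) in
/-- The interpretation of formal limits as copresheaves. -/
@[reducible]
noncomputable def interp : FreeLimits J A ⥤ (A ⥤ Type v)ᵒᵖ where
  obj X := X.val
  map f := (equivShrink _).symm f
  map_id _ := Equiv.symm_apply_apply _ _
  map_comp _ _ := Equiv.symm_apply_apply _ _

/-- The morphism of formal limits with a given interpretation. -/
noncomputable def homMk {X Y : FreeLimits J A} (f : X.val ⟶ Y.val) : X ⟶ Y :=
  equivShrink (X.val ⟶ Y.val) f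

@[simp]
theorem interp_map_homMk {X Y : FreeLimits J A} (f : X.val ⟶ Y.val) :
    (interp J A).map (homMk f) = f :=
  Equiv.symm_apply_apply _ f

theorem homMk_interp_map {X Y : FreeLimits J A} (f : X ⟶ Y) : homMk ((interp J A).map f) = f :=
  Equiv.apply_symm_apply (equivShrink (X.val ⟶ Y.val)) f

instance : (interp J A).Faithful where
  map_injective {X Y} f g h := by rw [← homMk_interp_map f, h, homMk_interp_map]

instance : (interp J A).Full where
  map_surjective f := ⟨homMk f, interp_map_homMk f⟩

theorem homMk_id (X : FreeLimits J A) : homMk (𝟙 X.val) = 𝟙 X := rfl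

theorem homMk_comp {X Y Z : FreeLimits J A} (f : X.val ⟶ Y.val) (g : Y.val ⟶ Z.val) :
    homMk (X := X) (Y := Z) (f ≫ g) = homMk f ≫ homMk g :=
  (interp J A).map_injective (by
    rw [Functor.map_comp, interp_map_homMk, interp_map_homMk, interp_map_homMk])

theorem homMk_comp_map {X Y Z : FreeLimits J A} (f : X.val ⟶ Y.val) (g : Y ⟶ Z) :
    homMk f ≫ g = homMk (X := X) (Y := Z) (f ≫ (interp J A).map g) :=
  (interp J A).map_injective (by
    rw [Functor.map_comp, interp_map_homMk, interp_map_homMk])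

variable (J A) in
/-- The inclusion of the generators. -/
noncomputable def incl : A ⥤ FreeLimits J A where
  obj a := ⟨_, .of a⟩
  map {a b} f := homMk (coyoneda.map f.op).op
  map_id a := by rw [op_id, coyoneda.map_id, op_id]; exact homMk_id _
  map_comp {a b c} f g := by
    rw [op_comp, coyoneda.map_comp, op_comp]
    exact homMk_comp (Y := ⟨_, .of b⟩) _ _

theorem interp_map_incl_map {a b : A} (f : a ⟶ b) :
    (interp J A).map ((incl J A).map f) = (coyoneda.map f.op).op :=
  interp_map_homMk _

instance : (incl J A).Full where
  map_surjective {a b} f := by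
    let g : coyoneda.obj (op b) ⟶ coyoneda.obj (op a) := ((interp J A).map f).unop
    refine ⟨(coyoneda.preimage g).unop, (interp J A).map_injective ?_⟩
    rw [interp_map_incl_map, Quiver.Hom.op_unop, coyoneda.map_preimage]
    rfl

/-- The chosen limit cone over a diagram of formal limits. -/
noncomputable def cone (i : ι) (D : J i ⥤ FreeLimits J A) : Cone D where
  pt := ⟨_, .lim i (D ⋙ interp J A) fun k => (D.obj k).term⟩
  π := { app k := homMk (limit.π (D ⋙ interp J A) k)
         naturality _ _ u := (Category.id_comp _).trans
          (((homMk_comp_map _ _).trans (congr_arg homMk (limit.w (D ⋙ interp J A) u))).symm) }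

theorem interp_map_cone_π {i : ι} (D : J i ⥤ FreeLimits J A) (k : J i) :
    (interp J A).map ((cone i D).π.app k) = limit.π (D ⋙ interp J A) k :=
  interp_map_homMk _

/-- The interpretation of the chosen cones. -/
noncomputable def isLimitInterpCone (i : ι) (D : J i ⥤ FreeLimits J A) :
    IsLimit ((interp J A).mapCone (cone i D)) :=
  IsLimit.ofIsoLimit (limit.isLimit (D ⋙ interp J A))
    (Cone.ext (Iso.refl _) fun k =>
      (interp_map_cone_π D k).symm.trans (Category.id_comp _).symm)

variable (J A) in
/-- The chosen limits of the free category with chosen limits. -/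
noncomputable def chosen : ChosenLimits J (FreeLimits J A) where
  cone := cone
  isLimit i D := ⟨isLimitOfReflects (interp J A) (isLimitInterpCone i D)⟩

/-- The induction principle for formal limits. -/
theorem induction {motive : FreeLimits J A → Prop} (of : ∀ a, motive ((incl J A).obj a))
    (lim : ∀ i (D : J i ⥤ FreeLimits J A), (∀ k, motive (D.obj k)) →
      motive ((chosen J A).cone i D).pt) (X : FreeLimits J A) : motive X := by
  obtain ⟨X, t⟩ := X
  induction t with
  | of a => exact of a
  | lim i D t ih =>
    let D' : J i ⥤ FreeLimits J A :=
      { obj k := ⟨D.obj k, t k⟩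
        map u := homMk (D.map u)
        map_id k := by rw [D.map_id]; exact homMk_id _
        map_comp {k l m} u w := by
          rw [D.map_comp]; exact homMk_comp (Y := ⟨D.obj l, t l⟩) _ _ }
    -- The diagram underlying `D'` agrees with `D` only up to a propositional equality of functors,
    -- so the family of terms has to be transported along it.
    have key : ∀ (E : J i ⥤ (A ⥤ Type v)ᵒᵖ) (s : ∀ k, LimitTerm J A (E.obj k)),
        E = D → s ≍ t →
        (⟨_, .lim i D t⟩ : FreeLimits J A) = ⟨_, .lim i E s⟩ := by
      rintro E s rfl h
      rw [eq_of_heq h]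
    have h : (⟨_, .lim i D t⟩ : FreeLimits J A) = ((chosen J A).cone i D').pt := by
      refine key _ _ ?_ HEq.rfl
      exact CategoryTheory.Functor.ext (fun _ => rfl) fun k l u =>
        (interp_map_homMk _).trans ((Category.id_comp _).trans (Category.comp_id _)).symm
    rw [h]
    exact lim i D' ih

end FreeLimits

end

end

/-! ### Realizing copresheaves along a functor -/

section
variable {A : Type u} [Category.{v} A] {B : Type u'} [Category.{v} B]

/-- The functor sending `b` to the copresheaf `Hom(b, F -)`. -/
def restrictedCoyoneda (F : A ⥤ B) : B ⥤ (A ⥤ Type v)ᵒᵖ :=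
  (coyoneda ⋙ (Functor.whiskeringLeft A B (Type v)).obj F).rightOp

namespace restrictedCoyoneda
variable {F : A ⥤ B}

/-- The action on elements of a morphism from a restricted representable copresheaf. -/
def ev {b : B} {X : (A ⥤ Type v)ᵒᵖ} (τ : (restrictedCoyoneda F).obj b ⟶ X) {a : A}
    (x : X.unop.obj a) : b ⟶ F.obj a :=
  τ.unop.app a x

theorem ev_ext {b : B} {X : (A ⥤ Type v)ᵒᵖ} {σ τ : (restrictedCoyoneda F).obj b ⟶ X}
    (h : ∀ (a : A) (x : X.unop.obj a), ev σ x = ev τ x) : σ = τ := by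
  apply Quiver.Hom.unop_inj
  ext a x
  exact h a x

theorem ev_map {b c : B} {X : (A ⥤ Type v)ᵒᵖ} (f : b ⟶ c) (τ : (restrictedCoyoneda F).obj c ⟶ X)
    {a : A} (x : X.unop.obj a) : ev ((restrictedCoyoneda F).map f ≫ τ) x = f ≫ ev τ x := rfl

theorem ev_naturality {b : B} {X : (A ⥤ Type v)ᵒᵖ} (τ : (restrictedCoyoneda F).obj b ⟶ X) {a a' : A}
    (u : a ⟶ a') (x : X.unop.obj a) : ev τ (X.unop.map u x) = ev τ x ≫ F.map u :=
  ConcreteCategory.congr_hom (τ.unop.naturality u) x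

/-- The morphism from a restricted representable copresheaf with a given action on elements. -/
def mk {b : B} {X : (A ⥤ Type v)ᵒᵖ} (e : ∀ {a : A}, X.unop.obj a → (b ⟶ F.obj a))
    (he : ∀ {a a' : A} (u : a ⟶ a') (x : X.unop.obj a), e (X.unop.map u x) = e x ≫ F.map u) :
    (restrictedCoyoneda F).obj b ⟶ X :=
  Quiver.Hom.op (X := X.unop) (Y := F ⋙ coyoneda.obj (op b))
    { app a := TypeCat.ofHom fun x => e x
      naturality a a' u := by
        ext x
        exact he u x }

/-- This is the Yoneda lemma: a morphism to the copresheaf represented by `a` is determined, by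
naturality, by its value at `𝟙 a`. -/
theorem isUniversalArrow {a : A} (τ : (restrictedCoyoneda F).obj (F.obj a) ⟶ op (coyoneda.obj (op a)))
    (h : ev τ (𝟙 a) = 𝟙 (F.obj a)) : IsUniversalArrow (restrictedCoyoneda F) τ := by
  have key {b : B} (σ : (restrictedCoyoneda F).obj b ⟶ op (coyoneda.obj (op a))) {a' : A}
      (x : a ⟶ a') : ev σ x = ev σ (𝟙 a) ≫ F.map x := by
    rw [← ev_naturality]
    exact congr_arg (ev σ) (Category.id_comp x).symm
  intro b
  constructor
  · intro f g w
    have := congr_arg (ev · (𝟙 a)) w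
    simpa only [ev_map, h, Category.comp_id] using this
  · intro σ
    refine ⟨ev σ (𝟙 a), ev_ext fun a' x => ?_⟩
    rw [ev_map, key τ x, h, Category.id_comp, key σ x]

end restrictedCoyoneda

/-- The realization of a corepresentable copresheaf. -/
def Realization.coyoneda (F : A ⥤ B) (a : A) :
    Realization (restrictedCoyoneda F) (op (coyoneda.obj (op a))) where
  pt := F.obj a
  hom := restrictedCoyoneda.mk (fun x => F.map x) (fun _ _ => F.map_comp _ _)
  univ := restrictedCoyoneda.isUniversalArrow _ (F.map_id a)

end

/-! ### Universal property of the free category with chosen limits -/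

section
variable {ι : Type} {J : ι → Type} [∀ i, SmallCategory (J i)]
  {A : Type (v + 1)} [Category.{v} A] {B : Type u} [Category.{v} B]

/-- The realization of formal limits in a category with chosen limits. -/
noncomputable def LimitTerm.realization (c : ChosenLimits J B) (F : A ⥤ B)
    {X : (A ⥤ Type v)ᵒᵖ} (t : LimitTerm J A X) : Realization (restrictedCoyoneda F) X :=
  match t with
  | of a => Realization.coyoneda F a
  | lim i D t => Realization.limit D (fun k => (t k).realization c F) _ (c.isLimit i _) _
      (limit.isLimit D)

namespace FreeLimits
open restrictedCoyoneda

section ext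
variable (c : ChosenLimits J B) (F : A ⥤ B)

/-- The functor on the free category with chosen limits induced by a functor on generators. -/
noncomputable def ext : FreeLimits J A ⥤ B where
  obj X := (X.term.realization c F).pt
  map {X Y} f := (X.term.realization c F).map (Y.term.realization c F) ((interp J A).map f)
  map_id X := by rw [CategoryTheory.Functor.map_id]; exact Realization.map_id _
  map_comp {X Y Z} f g := by rw [Functor.map_comp]; exact Realization.map_comp _ _ _ _ _

theorem incl_ext : incl J A ⋙ ext c F = F :=
  CategoryTheory.Functor.ext (fun _ => rfl) fun a b f => by
    refine .trans ?_ ((Category.id_comp _).trans (Category.comp_id _)).symm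
    refine (Realization.coyoneda F b).univ.lift_eq (ev_ext fun a' x => ?_)
    change F.map f ≫ F.map x = F.map (((interp J A).map ((incl J A).map f)).unop.app a' x)
    rw [interp_map_incl_map, ← F.map_comp]
    rfl

/-- The recursion takes the chosen limit at each formal limit, so the vertices agree definitionally.
The projections agree because factorisations through universal arrows are unique. -/
theorem ext_strictlyPreserved : (chosen J A).StrictlyPreserved c (ext c F) := by
  intro i D
  have h (k : J i) : (ext c F).map (((chosen J A).cone i D).π.app k) =
      (c.cone i (D ⋙ ext c F)).π.app k := by
    refine ((D.obj k).term.realization c F).univ.lift_eq (.symm ?_)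
    refine (congr_arg _ (interp_map_cone_π D k)).trans ?_
    exact (limit.isLimit (D ⋙ interp J A)).fac _ k
  have aux (d e : Cone (D ⋙ ext c F)) (hp : d.pt = e.pt)
      (hπ : ∀ k, d.π.app k = eqToHom hp ≫ e.π.app k) : d = e := by
    cases d; cases e; cases hp
    congr 1
    ext k
    simpa using hπ k
  exact aux _ _ rfl fun k => (h k).trans (Category.id_comp _).symm

end ext

section
variable {G H : FreeLimits J A ⥤ B} {P : A ⥤ B}

/-- The element of a copresheaf, as a morphism of formal limits to a generator. -/
noncomputable def elt {X : FreeLimits J A} {a : A} (x : X.val.unop.obj a) : X ⟶ (incl J A).obj a :=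
  homMk (coyonedaEquiv.symm x).op

theorem elt_map {X : FreeLimits J A} {a a' : A} (x : X.val.unop.obj a) (u : a ⟶ a') :
    elt (X.val.unop.map u x) = elt x ≫ (incl J A).map u :=
  (interp J A).map_injective (by
    rw [Functor.map_comp, interp_map_incl_map]
    refine (interp_map_homMk _).trans (.trans ?_
      (congr_arg (· ≫ (coyoneda.map u.op).op)
        (interp_map_homMk (Y := (incl J A).obj a) (coyonedaEquiv.symm x).op).symm))
    rw [coyonedaEquiv_symm_map]; rfl)

theorem map_elt {X Y : FreeLimits J A} {a : A} (f : X ⟶ Y) (y : Y.val.unop.obj a) :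
    elt (((interp J A).map f).unop.app a y) = f ≫ elt y :=
  (interp J A).map_injective (by
    rw [Functor.map_comp]
    refine (interp_map_homMk _).trans (.trans ?_
      (congr_arg ((interp J A).map f ≫ ·) (interp_map_homMk _).symm))
    apply Quiver.Hom.unop_inj
    apply coyonedaEquiv.injective
    exact (coyonedaEquiv.apply_symm_apply _).trans
      ((congr_arg _ (coyonedaEquiv.apply_symm_apply y)).symm.trans (coyonedaEquiv_comp _ _).symm))

theorem elt_id (a : A) :
    elt (X := (incl J A).obj a) (𝟙 a : (coyoneda.obj (op a)).obj a) = 𝟙 ((incl J A).obj a) := by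
  refine .trans (congr_arg homMk ?_) (homMk_id _)
  apply Quiver.Hom.unop_inj
  apply coyonedaEquiv.injective
  exact coyonedaEquiv.apply_symm_apply _

/-- The comparison of `Hom(G X, P -)` with `X` induced by a transformation on generators. -/
noncomputable def comparison (α : incl J A ⋙ G ⟶ P) : G ⋙ restrictedCoyoneda P ⟶ interp J A where
  app X := restrictedCoyoneda.mk (X := X.val) (fun x => G.map (elt x) ≫ α.app _) (fun u x => by
    rw [elt_map, G.map_comp, Category.assoc, Category.assoc]
    exact congr_arg _ (α.naturality u))
  naturality X Y f := by
    refine restrictedCoyoneda.ev_ext (F := P) (X := Y.val) fun a y => ?_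
    refine .trans ?_ (congr_arg (G.map · ≫ α.app a) (map_elt f y)).symm
    rw [G.map_comp, Category.assoc]
    rfl

theorem ev_comparison (α : incl J A ⋙ G ⟶ P) (X : FreeLimits J A) {a : A} (x : X.val.unop.obj a) :
    ev (X := X.val) ((comparison α).app X) x = G.map (elt x) ≫ α.app a := rfl

theorem ev_comparison_id (X : FreeLimits J A) {a : A} (x : X.val.unop.obj a) :
    ev (X := X.val) ((comparison (𝟙 (incl J A ⋙ H))).app X) x = H.map (elt x) :=
  Category.comp_id _

/-- Thus `H.obj X` realizes `X` along the restriction of `H` to generators. Generators are handled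
by Yoneda. At a formal limit, `H` preserves the chosen cone, and universal arrows are closed under
limits by `IsUniversalArrow.limit`. -/
theorem isUniversalArrow_comparison (hH : PreservesShapes J H) (X : FreeLimits J A) :
    IsUniversalArrow (restrictedCoyoneda (incl J A ⋙ H)) ((comparison (𝟙 (incl J A ⋙ H))).app X) := by
  induction X using induction with
  | of a =>
    refine restrictedCoyoneda.isUniversalArrow (F := incl J A ⋙ H) _ ?_
    refine (ev_comparison_id ((incl J A).obj a) _).trans ?_
    rw [elt_id]
    exact H.map_id _
  | lim i D ih =>
    have := hH i
    exact IsUniversalArrow.limit (Q := D ⋙ H) (D := D ⋙ interp J A)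
      { app k := (comparison (𝟙 (incl J A ⋙ H))).app (D.obj k)
        naturality _ _ u := (comparison (𝟙 (incl J A ⋙ H))).naturality (D.map u) } ih
      (isLimitOfPreserves H ((chosen J A).isLimit i D).some) (isLimitInterpCone i D)
      (fun k => ((comparison (𝟙 (incl J A ⋙ H))).naturality _).symm)

/-- A limit-preserving functor on the free category with chosen limits is the right Kan extension
of its restriction to the generators. -/
theorem whiskerLeft_incl_bijective (G : FreeLimits J A ⥤ B) (hH : PreservesShapes J H) :
    Function.Bijective fun β : G ⟶ H => Functor.whiskerLeft (incl J A) β := by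
  -- The right-hand side depends only on the restriction of `β`, and composition with a universal
  -- arrow is injective; this gives uniqueness and dictates the lift used for existence.
  have key (β : G ⟶ H) (X : FreeLimits J A) :
      (restrictedCoyoneda (incl J A ⋙ H)).map (β.app X) ≫
        (comparison (𝟙 (incl J A ⋙ H))).app X =
      (comparison (Functor.whiskerLeft (incl J A) β)).app X := by
    refine restrictedCoyoneda.ev_ext (F := incl J A ⋙ H) (X := X.val) fun a x => ?_
    refine (ev_map _ _ _).trans ?_
    rw [ev_comparison_id, ev_comparison]
    exact (β.naturality _).symm
  constructor
  · intro β γ h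
    ext X
    apply (isUniversalArrow_comparison hH X).hom_ext
    rw [key, key]
    exact congr_arg (fun t => (comparison t).app X) h
  · intro α
    refine ⟨{ app X := (isUniversalArrow_comparison hH X).lift ((comparison α).app X)
              naturality X Y f := ?_ }, ?_⟩
    · apply (isUniversalArrow_comparison hH Y).hom_ext
      rw [Functor.map_comp, Functor.map_comp, Category.assoc, Category.assoc,
        IsUniversalArrow.fac]
      refine ((comparison α).naturality f).trans (.trans ?_
        (congr_arg ((restrictedCoyoneda (incl J A ⋙ H)).map _ ≫ ·)
          ((comparison (𝟙 (incl J A ⋙ H))).naturality f).symm))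
      rw [← Category.assoc, IsUniversalArrow.fac]
    · ext a
      refine (isUniversalArrow_comparison hH ((incl J A).obj a)).lift_eq
        (restrictedCoyoneda.ev_ext (F := incl J A ⋙ H) (X := ((incl J A).obj a).val)
          fun a' x => ?_)
      refine (ev_map _ _ _).trans ?_
      rw [ev_comparison_id, ev_comparison]
      -- `α` is natural only for arrows of `A`; fullness of the inclusion shows that the elements of
      -- a generator are such arrows.
      obtain ⟨u, hu⟩ := (incl J A).map_surjective (elt x)
      rw [← hu]
      exact (α.naturality u).symm

end

/-- Functors that preserve the chosen limits strictly are determined by their restriction to the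
generators. -/
theorem functor_ext {c : ChosenLimits J B} {G H : FreeLimits J A ⥤ B}
    (hG : (chosen J A).StrictlyPreserved c G) (hH : (chosen J A).StrictlyPreserved c H)
    (h : incl J A ⋙ G = incl J A ⋙ H) : G = H := by
  -- The equality on generators extends to a transformation `θ`. Once each component is shown to be
  -- an `eqToHom`, naturality of `θ` is the equality of the functors on morphisms.
  obtain ⟨θ, hθ⟩ := (whiskerLeft_incl_bijective G hH.preservesShapes).2 (eqToHom h)
  have key (X : FreeLimits J A) : ∃ e : G.obj X = H.obj X, θ.app X = eqToHom e := by
    induction X using induction with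
    | of a =>
      exact ⟨Functor.congr_obj h a, by
        rw [← eqToHom_app h a]
        exact congr_arg (fun t => t.app a) hθ⟩
    | lim i D ih =>
      choose e he using ih
      have hD : D ⋙ G = D ⋙ H := CategoryTheory.Functor.ext e fun k l u => by
        have := θ.naturality (D.map u)
        rw [he, he] at this
        rw [← Category.assoc]
        refine .trans ?_ (congr_arg (· ≫ eqToHom (e l).symm) this)
        simp
      -- Both functors send the formal limit to the cone that `c` chooses, over diagrams that are
      -- equal by `hD`. The diagram is generalised so that this equality can be eliminated.
      have aux (E : J i ⥤ B) (h : D ⋙ G = E) (s : Cone E)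
          (hs : s = c.cone i E) :
          ∃ p : (G.mapCone ((chosen J A).cone i D)).pt = s.pt, ∀ k,
            (G.mapCone ((chosen J A).cone i D)).π.app k ≫ eqToHom (Functor.congr_obj h k) =
              eqToHom p ≫ s.π.app k := by
        subst h
        rw [hG i D]
        subst hs
        exact ⟨rfl, by simp⟩
      obtain ⟨p, hp⟩ := aux _ hD (H.mapCone ((chosen J A).cone i D)) (hH i D)
      have := hH.preservesShapes i
      refine ⟨p, (isLimitOfPreserves H ((chosen J A).isLimit i D).some).hom_ext fun k => ?_⟩
      refine .trans ?_ (hp k)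
      refine (θ.naturality _).symm.trans ?_
      rw [he]
      rfl
  choose e he using key
  refine CategoryTheory.Functor.ext e fun X Y f => ?_
  have := θ.naturality f
  rw [he, he] at this
  rw [← Category.assoc, ← this, Category.assoc, eqToHom_trans, eqToHom_refl, Category.comp_id]

end FreeLimits

end

/-! ### 2-monads from strictly free structures -/

/-- Strictly free structures on the objects of a strict bicategory, such that 2-cells to morphisms
of structures are determined by their restriction to the generators. -/
structure FreeStructures (D : Type u) [Bicategory.{w, v} D] where
  /-- structures on an object -/
  Str : D → Type u₁
  /-- morphisms of structures -/
  IsHom : ∀ {A B : D}, Str A → Str B → (A ⟶ B) → Prop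
  isHom_id : ∀ {A : D} (a : Str A), IsHom a a (𝟙 A)
  isHom_comp : ∀ {A B C : D} {a : Str A} {b : Str B} {c : Str C} {f : A ⟶ B} {g : B ⟶ C},
    IsHom a b f → IsHom b c g → IsHom a c (f ≫ g)
  /-- the object underlying the free structure -/
  obj : D → D
  /-- the free structure -/
  free : ∀ A : D, Str (obj A)
  /-- the inclusion of generators -/
  e : ∀ A : D, A ⟶ obj A
  /-- the extension of a 1-cell on generators -/
  ext : ∀ {A B : D}, Str B → (A ⟶ B) → (obj A ⟶ B)
  e_ext : ∀ {A B : D} (b : Str B) (f : A ⟶ B), e A ≫ ext b f = f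
  isHom_ext : ∀ {A B : D} (b : Str B) (f : A ⟶ B), IsHom (free A) b (ext b f)
  hom_ext : ∀ {A B : D} {b : Str B} {g h : obj A ⟶ B}, IsHom (free A) b g → IsHom (free A) b h →
    e A ≫ g = e A ≫ h → g = h
  bijective : ∀ {A B : D} {b : Str B} (g : obj A ⟶ B) {h : obj A ⟶ B}, IsHom (free A) b h →
    Function.Bijective fun β : g ⟶ h => e A ◁ β

namespace FreeStructures
open Bicategory TwoMonad

variable {D : Type u} [Bicategory.{w, v} D] [Bicategory.Strict D] (Φ : FreeStructures D)

theorem hom₂_ext {A B : D} {b : Φ.Str B} {g h : Φ.obj A ⟶ B} (hh : Φ.IsHom (Φ.free A) b h)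
    {β γ : g ⟶ h} (w : Φ.e A ◁ β = Φ.e A ◁ γ) : β = γ :=
  (Φ.bijective g hh).1 w

/-- The action of the free structure on 1-cells. -/
def map {A B : D} (f : A ⟶ B) : Φ.obj A ⟶ Φ.obj B := Φ.ext (Φ.free B) (f ≫ Φ.e B)

theorem isHom_map {A B : D} (f : A ⟶ B) : Φ.IsHom (Φ.free A) (Φ.free B) (Φ.map f) :=
  Φ.isHom_ext _ _

theorem e_map {A B : D} (f : A ⟶ B) : Φ.e A ≫ Φ.map f = f ≫ Φ.e B := Φ.e_ext _ _

/-- The multiplication. -/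
def mul (A : D) : Φ.obj (Φ.obj A) ⟶ Φ.obj A := Φ.ext (Φ.free A) (𝟙 _)

theorem isHom_mul (A : D) : Φ.IsHom (Φ.free (Φ.obj A)) (Φ.free A) (Φ.mul A) := Φ.isHom_ext _ _

theorem e_mul (A : D) : Φ.e (Φ.obj A) ≫ Φ.mul A = 𝟙 _ := Φ.e_ext _ _

/-- The action of the free structure on 2-cells. -/
noncomputable def map₂ {A B : D} {f g : A ⟶ B} (α : f ⟶ g) : Φ.map f ⟶ Φ.map g :=
  ((Φ.bijective (Φ.map f) (Φ.isHom_map g)).2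
    (eqToHom (Φ.e_map f) ≫ α ▷ Φ.e B ≫ eqToHom (Φ.e_map g).symm)).choose

theorem e_map₂ {A B : D} {f g : A ⟶ B} (α : f ⟶ g) :
    Φ.e A ◁ Φ.map₂ α = eqToHom (Φ.e_map f) ≫ α ▷ Φ.e B ≫ eqToHom (Φ.e_map g).symm :=
  ((Φ.bijective (Φ.map f) (Φ.isHom_map g)).2
    (eqToHom (Φ.e_map f) ≫ α ▷ Φ.e B ≫ eqToHom (Φ.e_map g).symm)).choose_spec

theorem map_id (A : D) : Φ.map (𝟙 A) = 𝟙 (Φ.obj A) :=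
  Φ.hom_ext (Φ.isHom_map _) (Φ.isHom_id _) (by rw [e_map, Strict.id_comp, Strict.comp_id])

theorem map_comp {A B C : D} (f : A ⟶ B) (g : B ⟶ C) : Φ.map (f ≫ g) = Φ.map f ≫ Φ.map g :=
  Φ.hom_ext (Φ.isHom_map _) (Φ.isHom_comp (Φ.isHom_map _) (Φ.isHom_map _)) (by
    rw [e_map, ← Strict.assoc, e_map, Strict.assoc, Strict.assoc, e_map])

theorem map_mul {A B : D} (f : A ⟶ B) :
    Φ.map (Φ.map f) ≫ Φ.mul B = Φ.mul A ≫ Φ.map f :=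
  Φ.hom_ext (Φ.isHom_comp (Φ.isHom_map _) (Φ.isHom_mul _))
    (Φ.isHom_comp (Φ.isHom_mul _) (Φ.isHom_map _)) (by
      rw [← Strict.assoc, e_map, Strict.assoc, e_mul, Strict.comp_id, ← Strict.assoc, e_mul,
        Strict.id_comp])

theorem map₂_whiskerLeft {A B C : D} (f : A ⟶ B) {g h : B ⟶ C} (η : g ⟶ h) :
    Φ.map₂ (f ◁ η) = eqToHom (Φ.map_comp f g) ≫ Φ.map f ◁ Φ.map₂ η ≫
      eqToHom (Φ.map_comp f h).symm :=
  Φ.hom₂_ext (Φ.isHom_map _) (by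
    rw [e_map₂, whiskerLeft_comp, whiskerLeft_comp, whisker_whisker, congr_whiskerLeft (Φ.e_map f),
      comp_whisker, e_map₂]
    simp only [whiskerLeft_comp, whiskerLeft_eqToHom,
      whisker_left_right, Category.assoc, eqToHom_trans, eqToHom_trans_assoc])

theorem map₂_whiskerRight {A B C : D} {f g : A ⟶ B} (η : f ⟶ g) (h : B ⟶ C) :
    Φ.map₂ (η ▷ h) = eqToHom (Φ.map_comp f h) ≫ Φ.map₂ η ▷ Φ.map h ≫
      eqToHom (Φ.map_comp g h).symm :=
  Φ.hom₂_ext (Φ.isHom_map _) (by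
    simp only [e_map₂, whiskerLeft_comp, whiskerLeft_eqToHom,
      whisker_left_right, whisker_right_right, comp_whiskerRight, eqToHom_whiskerRight,
      whiskerRight_congr (Φ.e_map h), Category.assoc, eqToHom_trans, eqToHom_trans_assoc])

theorem map₂_mul {A B : D} {f g : A ⟶ B} (α : f ⟶ g) :
    Φ.map₂ (Φ.map₂ α) ▷ Φ.mul B ≫ eqToHom (Φ.map_mul g) =
      eqToHom (Φ.map_mul f) ≫ Φ.mul A ◁ Φ.map₂ α :=
  Φ.hom₂_ext (Φ.isHom_comp (Φ.isHom_mul _) (Φ.isHom_map _)) (by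
    simp only [e_map₂, whiskerLeft_comp, whiskerLeft_eqToHom, whisker_whisker,
      whisker_left_right, whisker_right_right, comp_whiskerRight, eqToHom_whiskerRight,
      congr_whiskerLeft (Φ.e_mul A), id_whiskerLeft, whiskerRight_id,
      Strict.leftUnitor_eqToIso, Strict.rightUnitor_eqToIso, eqToIso.hom, eqToIso.inv,
      whiskerRight_congr (Φ.e_mul B), Category.assoc, eqToHom_trans, eqToHom_trans_assoc])

/-- The 2-functor of free structures. -/
noncomputable def functor : StrictPseudofunctor D D :=
  StrictPseudofunctor.mk''
    { obj := Φ.obj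
      map := Φ.map
      map₂ := Φ.map₂
      map₂_id := fun f => Φ.hom₂_ext (Φ.isHom_map f) (by simp [e_map₂])
      map₂_comp := fun {_ _ _ _ h} _ _ => Φ.hom₂_ext (Φ.isHom_map h) (by simp [e_map₂])
      map_id := Φ.map_id
      map_comp := Φ.map_comp
      map₂_whisker_left := Φ.map₂_whiskerLeft
      map₂_whisker_right := Φ.map₂_whiskerRight }

/-- The 2-monad of free structures. -/
noncomputable def monad : TwoMonad D where
  functor := Φ.functor
  e := Φ.e
  m := Φ.mul
  e_natural f := (Φ.e_map f).symm
  e_natural₂ {A B f g} α := by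
    have h : α ▷ Φ.e B ≫ eqToHom (Φ.e_map g).symm =
        eqToHom (Φ.e_map f).symm ≫ Φ.e A ◁ Φ.map₂ α := by simp [e_map₂]
    exact h
  m_natural f := Φ.map_mul f
  m_natural₂ α := Φ.map₂_mul α
  e_m := Φ.e_mul
  map_e_m A := Φ.hom_ext (Φ.isHom_comp (Φ.isHom_map _) (Φ.isHom_mul _)) (Φ.isHom_id _) (by
    have h : Φ.e A ≫ Φ.map (Φ.e A) ≫ Φ.mul A = Φ.e A ≫ 𝟙 _ := by
      rw [← Strict.assoc, e_map, Strict.assoc, e_mul]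
    exact h)
  m_m A := Φ.hom_ext (Φ.isHom_comp (Φ.isHom_mul _) (Φ.isHom_mul _))
    (Φ.isHom_comp (Φ.isHom_map _) (Φ.isHom_mul _)) (by
      have h : Φ.e _ ≫ Φ.mul (Φ.obj A) ≫ Φ.mul A = Φ.e _ ≫ Φ.map (Φ.mul A) ≫ Φ.mul A := by
        rw [← Strict.assoc, e_mul, Strict.id_comp, ← Strict.assoc, e_map, Strict.assoc, e_mul,
          Strict.comp_id]
      exact h)

end FreeStructures

/-! ### Pseudomorphisms and 2-cells determined along the unit -/

namespace TwoMonad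
open Bicategory

variable {D : Type u} [Bicategory.{w, v} D] [Bicategory.Strict D] {S : TwoMonad D}

theorem e_map₂ {A B : D} {f g : A ⟶ B} (α : f ⟶ g) :
    S.e A ◁ S.functor.map₂ α =
      eqToHom (S.e_natural f).symm ≫ α ▷ S.e B ≫ eqToHom (S.e_natural g) := by
  rw [S.e_natural₂, eqToHom_trans_assoc, eqToHom_refl, Category.id_comp]

/-- If 2-cells to the codomain are determined by their restriction along the unit, then every 2-cell
between pseudomorphisms is an algebra 2-cell. -/
theorem isAlgTwoCell_of_injective {A B : D} {a : S.Alg A} {b : S.Alg B} {f g : A ⟶ B}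
    (φ : PseudoHom a b f) (ψ : PseudoHom a b g) (α : f ⟶ g)
    (h : ∀ β γ : S.functor.map f ≫ b.str ⟶ a.str ≫ g, S.e A ◁ β = S.e A ◁ γ → β = γ) :
    IsAlgTwoCell φ ψ α := by
  -- By the unit laws of `φ`, `ψ` and of the algebras, both sides restrict along `S.e A` to `α`, up
  -- to transport along equalities.
  apply h
  simp only [whiskerLeft_comp, φ.e_cell, ψ.e_cell, whisker_whisker, whisker_left_right, e_map₂,
    comp_whiskerRight, whisker_right_right, eqToHom_whiskerRight, congr_whiskerLeft a.e_str,
    whiskerRight_congr b.e_str, id_whiskerLeft, whiskerRight_id,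
      Strict.leftUnitor_eqToIso, Strict.rightUnitor_eqToIso, eqToIso.hom, eqToIso.inv,
      Category.assoc, eqToHom_trans, eqToHom_trans_assoc]

/-- A 1-cell is a pseudomorphism if 2-cells between the relevant 1-cells are determined by
their restrictions along the unit. -/
theorem nonempty_pseudoHom {A B : D} {a : S.Alg A} {b : S.Alg B} {f : A ⟶ B}
    (h₁ : ∀ g, Function.Bijective fun β : g ⟶ S.functor.map f ≫ b.str => S.e A ◁ β)
    (h₂ : ∀ g, Function.Bijective fun β : g ⟶ a.str ≫ f => S.e A ◁ β)
    (h₃ : ∀ g, Function.Injective fun β : g ⟶ S.functor.map a.str ≫ a.str ≫ f =>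
      S.e (S.functor.obj A) ◁ β) : Nonempty (PseudoHom a b f) := by
  have hf : S.e A ≫ S.functor.map f ≫ b.str = S.e A ≫ a.str ≫ f := by
    rw [← Strict.assoc, ← Strict.assoc, ← S.e_natural, a.e_str, Strict.assoc, b.e_str,
      Strict.comp_id, Strict.id_comp]
  -- The unit law forces the cell to extend the identity on generators. The extensions in the two
  -- directions are mutually inverse by uniqueness.
  obtain ⟨p, hp⟩ := (h₂ (S.functor.map f ≫ b.str)).2 (eqToHom hf)
  obtain ⟨q, hq⟩ := (h₁ (a.str ≫ f)).2 (eqToHom hf.symm)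
  dsimp only at hp hq
  refine ⟨{
    cell := ⟨p, q, (h₁ _).1 (by simp [hp, hq]), (h₂ _).1 (by simp [hp, hq])⟩
    e_cell := hp
    m_cell := h₃ _ ?_ }⟩
  -- For the multiplication law, both sides are compared after restriction along `S.e (S.functor.obj
  -- A)`. On the left this cancels `S.m A` and leaves `p`. On the right, naturality of the unit
  -- turns the image of `p` under `S` back into `p`, and the second factor into an identity by `hp`.
  have hn : S.e (S.functor.obj A) ≫ S.functor.map a.str = a.str ≫ S.e A := (S.e_natural _).symm
  dsimp only
  rw [whiskerLeft_comp, whiskerLeft_comp, whiskerLeft_comp, whiskerLeft_comp, whisker_whisker,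
    whisker_whisker _ (S.functor.map a.str), congr_whiskerLeft hn, comp_whisker a.str, hp,
    whisker_left_right, e_map₂]
  simp only [whiskerLeft_eqToHom, comp_whiskerRight, whisker_right_right, eqToHom_whiskerRight,
    congr_whiskerLeft (S.e_m A),
    whiskerRight_congr b.e_str, id_whiskerLeft, whiskerRight_id,
      Strict.leftUnitor_eqToIso, Strict.rightUnitor_eqToIso, eqToIso.hom, eqToIso.inv,
      Category.assoc, eqToHom_trans, eqToHom_trans_assoc]

end TwoMonad

/-! ### Algebras for the 2-monad of free structures -/

namespace FreeStructures
open Bicategory TwoMonad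

variable {D : Type u} [Bicategory.{w, v} D] [Bicategory.Strict D] (Φ : FreeStructures D)

/-- The algebra determined by a structure. -/
noncomputable def alg {A : D} (c : Φ.Str A) : Φ.monad.Alg A where
  str := Φ.ext c (𝟙 A)
  e_str := Φ.e_ext c (𝟙 A)
  m_str := Φ.hom_ext (Φ.isHom_comp (Φ.isHom_mul A) (Φ.isHom_ext c _))
    (Φ.isHom_comp (Φ.isHom_map _) (Φ.isHom_ext c _)) (by
      have h : Φ.e _ ≫ Φ.mul A ≫ Φ.ext c (𝟙 A) = Φ.e _ ≫ Φ.map (Φ.ext c (𝟙 A)) ≫ Φ.ext c (𝟙 A) := by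
        rw [← Strict.assoc, e_mul, Strict.id_comp, ← Strict.assoc, e_map, Strict.assoc, e_ext,
          Strict.comp_id]
      exact h)

theorem alg_eq {A : D} {c : Φ.Str A} {a : Φ.monad.Alg A} (h : Φ.IsHom (Φ.free A) c a.str) :
    Φ.alg c = a :=
  Alg.ext (Φ.hom_ext (Φ.isHom_ext c _) h ((Φ.e_ext c _).trans a.e_str.symm))

theorem isStrictHom_alg {A B : D} {a : Φ.Str A} {b : Φ.Str B} {f : A ⟶ B} (h : Φ.IsHom a b f) :
    IsStrictHom (Φ.alg a) (Φ.alg b) f :=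
  Φ.hom_ext (Φ.isHom_comp (Φ.isHom_map f) (Φ.isHom_ext b _)) (Φ.isHom_comp (Φ.isHom_ext a _) h) (by
    have h : Φ.e A ≫ Φ.map f ≫ Φ.ext b (𝟙 B) = Φ.e A ≫ Φ.ext a (𝟙 A) ≫ f := by
      rw [← Strict.assoc, e_map, Strict.assoc, e_ext, ← Strict.assoc, e_ext, Strict.id_comp,
        Strict.comp_id]
    exact h)

/-- The structure map of an algebra is right adjoint to the unit. -/
theorem exists_counit {A : D} (a : Φ.obj A ⟶ A) (he : Φ.e A ≫ a = 𝟙 A)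
    (hm : Φ.mul A ≫ a = Φ.map a ≫ a) : ∃ κ : a ≫ Φ.e A ⟶ 𝟙 (Φ.obj A),
      Φ.e A ◁ κ = eqToHom (by rw [← Strict.assoc, he, Strict.id_comp, Strict.comp_id]) ∧
      κ ▷ a = eqToHom (by rw [Strict.assoc, he, Strict.id_comp, Strict.comp_id]) := by
  -- The two canonical maps from the free structure to its double agree on generators, and `Φ.map
  -- (Φ.e A)` is a morphism of structures, so the identity on generators extends to `l`.
  obtain ⟨l, hl⟩ := (Φ.bijective (Φ.e (Φ.obj A)) (Φ.isHom_map (Φ.e A))).2 (eqToHom (Φ.e_map _).symm)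
  dsimp only at hl
  have h₁ : Φ.map (Φ.e A) ≫ Φ.map a = 𝟙 _ := by rw [← map_comp, he, map_id]
  have h₂ : Φ.map (Φ.e A) ≫ Φ.mul A = 𝟙 _ :=
    Φ.hom_ext (Φ.isHom_comp (Φ.isHom_map _) (Φ.isHom_mul _)) (Φ.isHom_id _) (by
      rw [← Strict.assoc, e_map, Strict.assoc, e_mul])
  have h₃ : l ▷ Φ.mul A = eqToHom ((Φ.e_mul A).trans h₂.symm) :=
    Φ.hom₂_ext (Φ.isHom_comp (Φ.isHom_map _) (Φ.isHom_mul _)) (by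
      rw [whisker_left_right, hl]
      simp)
  -- Whiskering `l` with `Φ.map a` gives a 2-cell from `a ≫ Φ.e A`, by naturality of the unit, to
  -- the identity, as `a` is a retraction of the unit. After a further whiskering with `a`, the law
  -- `hm` replaces `Φ.map a` by `Φ.mul A`, and `h₃` makes the result trivial.
  refine ⟨eqToHom (Φ.e_map a).symm ≫ l ▷ Φ.map a ≫ eqToHom h₁, ?_, ?_⟩
  · rw [whiskerLeft_comp, whiskerLeft_comp, whisker_left_right, hl]
    simp
  · rw [comp_whiskerRight, comp_whiskerRight, whisker_right_right, whiskerRight_congr hm.symm]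
    have h₄ := whisker_right_right l (Φ.mul A) a
    rw [h₃, eq_comm, eqToHom_comp_iff, comp_eqToHom_iff] at h₄
    rw [h₄]
    simp

end FreeStructures

/-! ### Algebras of the free 2-monad as choices of limits -/

section
variable {ι : Type} {J : ι → Type} [∀ i, SmallCategory (J i)]

namespace ChosenLimits
variable {K : Type} [SmallCategory K] {A : Type u} [Category.{v} A] {B : Type u'} [Category.{v'} B]

theorem mapCone_heq {F G : A ⥤ B} (h : F = G) {D : K ⥤ A} (s : Cone D) :
    F.mapCone s ≍ G.mapCone s := by
  subst h; rfl

theorem mapCone_heq_of_heq (F : A ⥤ B) {D D' : K ⥤ A} (h : D = D') {s : Cone D} {s' : Cone D'}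
    (hs : s ≍ s') : F.mapCone s ≍ F.mapCone s' := by
  subst h; cases hs; rfl

theorem cone_heq (c : ChosenLimits J A) {i : ι} {D D' : J i ⥤ A} (h : D = D') :
    c.cone i D ≍ c.cone i D' := by
  subst h; rfl

theorem nonempty_isLimit_cast {D D' : K ⥤ A} (h : D = D') {s : Cone D} (hs : IsLimit s) :
    Nonempty (IsLimit (cast (congr_arg Cone h) s)) := by
  subst h
  exact ⟨hs⟩

end ChosenLimits

variable (J) in
/-- The free categories with chosen limits. -/
noncomputable def freeLimits : FreeStructures.{v + 1, v + 1, v + 2, v + 1} Cat.{v, v + 1} where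
  Str A := ChosenLimits J A
  IsHom a b f := a.StrictlyPreserved b f.toFunctor
  isHom_id a := .id a
  isHom_comp hf hg := hf.comp hg
  obj A := Cat.of (FreeLimits J A)
  free A := FreeLimits.chosen J A
  e A := (FreeLimits.incl J A).toCatHom
  ext b f := (FreeLimits.ext b f.toFunctor).toCatHom
  e_ext b f := Cat.ext (FreeLimits.incl_ext b f.toFunctor)
  isHom_ext b f := FreeLimits.ext_strictlyPreserved b f.toFunctor
  hom_ext hg hh h := Cat.ext (FreeLimits.functor_ext hg hh (congr_arg (·.toFunctor) h))
  bijective g h hh := by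
    have := FreeLimits.whiskerLeft_incl_bijective g.toFunctor hh.preservesShapes
    constructor
    · intro β γ w
      exact Cat.Hom₂.ext (this.1 (congr_arg (·.toNatTrans) w))
    · intro α
      obtain ⟨β, hβ⟩ := this.2 α.toNatTrans
      exact ⟨⟨β⟩, Cat.Hom₂.ext hβ⟩

namespace freeLimits
open FreeLimits

theorem eqToHom_toNatTrans_app {A B : Cat.{v, u}} {F G : A ⟶ B} (h : F = G) (x : A) :
    (eqToHom h).toNatTrans.app x = eqToHom (by rw [h]) := by
  subst h
  rfl

theorem nonempty_adjunction {A : Type u} [Category.{v} A] {E : Type u'} [Category.{v'} E]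
    {I : A ⥤ E} {F : E ⥤ A} (hF : I ⋙ F = 𝟭 A) (κ : F ⋙ I ⟶ 𝟭 E)
    (h₁ : ∀ x, ∃ p, κ.app (I.obj x) = eqToHom p) (h₂ : ∀ y, ∃ p, F.map (κ.app y) = eqToHom p) :
    Nonempty (I ⊣ F) :=
  ⟨Adjunction.mkOfUnitCounit
    { unit := eqToHom hF.symm
      counit := κ
      left_triangle := by
        ext x
        obtain ⟨p, hp⟩ := h₁ x
        simp [hp, eqToHom_map]
      right_triangle := by
        ext x
        obtain ⟨p, hp⟩ := h₂ x
        simp [hp] }⟩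

/-- The structure map of an algebra preserves limits. -/
theorem preservesShapes_of_isAlg {A : Cat.{v, v + 1}} (a : (freeLimits J).obj A ⟶ A)
    (he : (freeLimits J).e A ≫ a = 𝟙 A)
    (hm : (freeLimits J).mul A ≫ a = (freeLimits J).map a ≫ a) : PreservesShapes J a.toFunctor := by
  obtain ⟨κ, h₁, h₂⟩ := (freeLimits J).exists_counit a he hm
  let F : FreeLimits J A ⥤ A := a.toFunctor
  obtain ⟨adj⟩ := nonempty_adjunction (I := incl J A) (F := F)
    (congr_arg (·.toFunctor) he) κ.toNatTrans
    (fun x => ⟨_, (congr_arg (fun t => t.toNatTrans.app x) h₁).trans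
      (eqToHom_toNatTrans_app _ _)⟩)
    (fun y => ⟨_, (congr_arg (fun t => t.toNatTrans.app y) h₂).trans
      (eqToHom_toNatTrans_app _ _)⟩)
  have := adj.rightAdjoint_preservesLimits.{0, 0}
  exact fun i => inferInstanceAs (PreservesLimitsOfShape (J i) F)

/-- Every algebra structure map preserves strictly a choice of limits. -/
theorem exists_strictlyPreserved {A : Cat.{v, v + 1}} (a : (freeLimits J).obj A ⟶ A)
    (he : (freeLimits J).e A ≫ a = 𝟙 A)
    (hm : (freeLimits J).mul A ≫ a = (freeLimits J).map a ≫ a) :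
    ∃ c : ChosenLimits J A, (chosen J A).StrictlyPreserved c a.toFunctor := by
  have hF : incl J A ⋙ a.toFunctor = 𝟭 A := congr_arg (·.toFunctor) he
  let F : FreeLimits J A ⥤ A := a.toFunctor
  have hD {i : ι} (D : J i ⥤ A) : (D ⋙ incl J A) ⋙ F = D :=
    (congr_arg (D ⋙ ·) hF).trans D.comp_id
  -- The only possible choice: regard `D` as a diagram of generators, take its formal limit, and
  -- apply `a`. The result is a limit cone because `a`, being a right adjoint, preserves limits.
  refine ⟨{
    cone i D := cast (congr_arg Cone (hD D)) (F.mapCone ((chosen J A).cone i (D ⋙ incl J A)))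
    isLimit i D := ChosenLimits.nonempty_isLimit_cast (hD D)
      (have : PreservesLimitsOfShape (J i) F := preservesShapes_of_isAlg a he hm i
       isLimitOfPreserves F ((chosen J A).isLimit i (D ⋙ incl J A)).some) },
    fun i D => eq_of_heq ?_⟩
  let S : FreeLimits J (FreeLimits J A) ⥤ FreeLimits J A := ((freeLimits J).map a).toFunctor
  let m : FreeLimits J (FreeLimits J A) ⥤ FreeLimits J A := ((freeLimits J).mul A).toFunctor
  let j : FreeLimits J A ⥤ FreeLimits J (FreeLimits J A) := incl J (FreeLimits J A)
  have hS : (chosen J _).StrictlyPreserved (chosen J A) S := (freeLimits J).isHom_map a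
  have hmul : (chosen J _).StrictlyPreserved (chosen J A) m := (freeLimits J).isHom_mul A
  have hjm : j ⋙ m = 𝟭 _ := congr_arg (·.toFunctor) ((freeLimits J).e_mul A)
  have hjS : j ⋙ S = a.toFunctor ⋙ incl J A := congr_arg (·.toFunctor) ((freeLimits J).e_map a)
  have hma : m ⋙ a.toFunctor = S ⋙ a.toFunctor := congr_arg (·.toFunctor) hm
  -- Associativity of `a` is applied to the formal limit `x` of the formal objects of `D`, taken as
  -- new generators. Multiplication sends `x` to the chosen cone over `D`; `S` sends it to the
  -- formal limit of the diagram of generators `D ⋙ a`. Hence `a` sends both to the same cone.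
  let x := (chosen J _).cone i (D ⋙ j)
  have h₁ : m.mapCone x ≍ (chosen J A).cone i D :=
    (heq_of_eq (hmul i (D ⋙ j))).trans
      ((chosen J A).cone_heq ((congr_arg (D ⋙ ·) hjm).trans D.comp_id))
  have h₂ : S.mapCone x ≍ (chosen J A).cone i (D ⋙ a.toFunctor ⋙ incl J A) :=
    (heq_of_eq (hS i (D ⋙ j))).trans
      ((chosen J A).cone_heq (congr_arg (D ⋙ ·) hjS))
  refine .trans ?_ (cast_heq _ _).symm
  refine (ChosenLimits.mapCone_heq_of_heq a.toFunctor
    ((congr_arg (D ⋙ ·) hjm).trans D.comp_id) h₁).symm.trans ?_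
  refine .trans ?_ (ChosenLimits.mapCone_heq_of_heq a.toFunctor
    (congr_arg (D ⋙ ·) hjS) h₂)
  exact ChosenLimits.mapCone_heq hma x

/-- The structure map recovers the choice: the chosen cone over `D` is the image of the formal limit
of `D` regarded as a diagram of generators. -/
theorem alg_injective {A : Cat.{v, v + 1}} {c c' : ChosenLimits J A}
    (h : (freeLimits J).alg c = (freeLimits J).alg c') : c = c' := by
  refine ChosenLimits.ext' fun i D => ?_
  have hs : (freeLimits J).ext c (𝟙 A) = (freeLimits J).ext c' (𝟙 A) := congr_arg (·.str) h
  have h₁ : (chosen J A).StrictlyPreserved c ((freeLimits J).ext c (𝟙 A)).toFunctor :=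
    (freeLimits J).isHom_ext c (𝟙 A)
  have h₂ : (chosen J A).StrictlyPreserved c' ((freeLimits J).ext c (𝟙 A)).toFunctor := by
    rw [hs]
    exact (freeLimits J).isHom_ext c' (𝟙 A)
  have hF : incl J A ⋙ ((freeLimits J).ext c (𝟙 A)).toFunctor = 𝟭 A :=
    congr_arg (·.toFunctor) ((freeLimits J).e_ext c (𝟙 A))
  have h₃ := (h₁ i (D ⋙ incl J A)).symm.trans (h₂ i (D ⋙ incl J A))
  have hD : (D ⋙ incl J A) ⋙ ((freeLimits J).ext c (𝟙 A)).toFunctor = D :=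
    (congr_arg (D ⋙ ·) hF).trans D.comp_id
  rwa [hD] at h₃

variable (J) in
/-- Algebras for the free monad are the same as choices of limits. -/
noncomputable def algEquiv (A : Cat.{v, v + 1}) : (freeLimits J).monad.Alg A ≃ ChosenLimits J A :=
  (Equiv.ofBijective (freeLimits J).alg ⟨fun _ _ => alg_injective, fun a => by
    obtain ⟨c, hc⟩ := exists_strictlyPreserved a.str a.e_str a.m_str
    exact ⟨c, (freeLimits J).alg_eq hc⟩⟩).symm

/-- Evaluating the strict square at the formal limit of `D ⋙ incl J A` compares the image under `f`
of the cone chosen by `c` with the cone chosen by `c'`. -/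
theorem strictlyPreserved_of_isStrictHom {A B : Cat.{v, v + 1}} {c : ChosenLimits J A}
    {c' : ChosenLimits J B} {f : A ⟶ B}
    (h : TwoMonad.IsStrictHom ((freeLimits J).alg c) ((freeLimits J).alg c') f) :
    c.StrictlyPreserved c' f.toFunctor := by
  intro i D
  have h : (freeLimits J).map f ≫ (freeLimits J).ext c' (𝟙 B) = (freeLimits J).ext c (𝟙 A) ≫ f := h
  have h₁ : (chosen J A).StrictlyPreserved c ((freeLimits J).ext c (𝟙 A)).toFunctor :=
    (freeLimits J).isHom_ext c (𝟙 A)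
  have h₂ : (chosen J A).StrictlyPreserved c' (((freeLimits J).ext c (𝟙 A)) ≫ f).toFunctor := by
    rw [← h]
    exact (freeLimits J).isHom_comp ((freeLimits J).isHom_map f) ((freeLimits J).isHom_ext c' (𝟙 B))
  have hF : incl J A ⋙ ((freeLimits J).ext c (𝟙 A)).toFunctor = 𝟭 A :=
    congr_arg (·.toFunctor) ((freeLimits J).e_ext c (𝟙 A))
  have hD : (D ⋙ incl J A) ⋙ ((freeLimits J).ext c (𝟙 A)).toFunctor = D :=
    (congr_arg (D ⋙ ·) hF).trans D.comp_id
  have h₃ : f.toFunctor.mapCone (c.cone i ((D ⋙ incl J A) ⋙ ((freeLimits J).ext c (𝟙 A)).toFunctor)) =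
      c'.cone i (((D ⋙ incl J A) ⋙ ((freeLimits J).ext c (𝟙 A)).toFunctor) ⋙ f.toFunctor) :=
    (congr_arg f.toFunctor.mapCone (h₁ i (D ⋙ incl J A))).symm.trans (h₂ i (D ⋙ incl J A))
  rwa [hD] at h₃

theorem isStrictHom_iff {A B : Cat.{v, v + 1}} (a : (freeLimits J).monad.Alg A)
    (b : (freeLimits J).monad.Alg B) (f : A ⟶ B) : TwoMonad.IsStrictHom a b f ↔
      (algEquiv J A a).StrictlyPreserved (algEquiv J B b) f.toFunctor := by
  obtain ⟨c, rfl⟩ := (algEquiv J A).symm.surjective a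
  obtain ⟨c', rfl⟩ := (algEquiv J B).symm.surjective b
  rw [Equiv.apply_symm_apply, Equiv.apply_symm_apply]
  exact ⟨strictlyPreserved_of_isStrictHom, (freeLimits J).isStrictHom_alg⟩

end freeLimits

end

/-! ### Arbitrary 2-monads whose algebras are choices of limits -/

namespace TwoMonad
open Bicategory

section
variable {D : Type u} [Bicategory.{w, v} D] [Bicategory.Strict D] (S : TwoMonad D)

/-- The free algebra on an object. -/
def freeAlg (A : D) : S.Alg (S.functor.obj A) where
  str := S.m A
  e_str := S.e_m A
  m_str := S.m_m A

variable {S}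

theorem IsStrictHom.comp {A B C : D} {a : S.Alg A} {b : S.Alg B} {c : S.Alg C} {f : A ⟶ B}
    {g : B ⟶ C} (hf : IsStrictHom a b f) (hg : IsStrictHom b c g) : IsStrictHom a c (f ≫ g) := by
  rw [IsStrictHom] at *
  rw [S.functor.map_comp, Strict.assoc, hg, ← Strict.assoc, hf, Strict.assoc]

theorem isStrictHom_map {A B : D} (f : A ⟶ B) :
    IsStrictHom (S.freeAlg A) (S.freeAlg B) (S.functor.map f) :=
  S.m_natural f

theorem isStrictHom_str {A : D} (a : S.Alg A) : IsStrictHom (S.freeAlg A) a a.str :=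
  a.m_str.symm

theorem IsStrictHom.eq_map_str {A B : D} {b : S.Alg B} {g : S.functor.obj A ⟶ B}
    (hg : IsStrictHom (S.freeAlg A) b g) : g = S.functor.map (S.e A ≫ g) ≫ b.str := by
  have h : S.functor.map g ≫ b.str = S.m A ≫ g := hg
  rw [S.functor.map_comp, Strict.assoc, h, ← Strict.assoc, S.map_e_m, Strict.id_comp]

theorem IsStrictHom.hom_ext {A B : D} {b : S.Alg B} {g h : S.functor.obj A ⟶ B}
    (hg : IsStrictHom (S.freeAlg A) b g) (hh : IsStrictHom (S.freeAlg A) b h)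
    (w : S.e A ≫ g = S.e A ≫ h) : g = h := by
  rw [hg.eq_map_str, hh.eq_map_str, w]

end

variable {ι : Type} {J : ι → Type} [∀ i, SmallCategory (J i)] {S : TwoMonad Cat.{v, v + 1}}

variable (S J) in
/-- The 1-dimensional part of the characterisation of the 2-monad for categories with chosen
limits of shapes `J`. -/
structure LimitAlgebras where
  /-- algebras are choices of limits -/
  equiv : ∀ A : Cat.{v, v + 1}, S.Alg A ≃ ChosenLimits J A
  isStrictHom_iff : ∀ {A B : Cat.{v, v + 1}} (a : S.Alg A) (b : S.Alg B) (f : A ⟶ B),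
    IsStrictHom a b f ↔ (equiv A a).StrictlyPreserved (equiv B b) f.toFunctor

namespace LimitAlgebras
open FreeLimits
variable (Ψ : S.LimitAlgebras J)

include Ψ

theorem preservesShapes {A B : Cat.{v, v + 1}} {a : S.Alg A} {b : S.Alg B} {f : A ⟶ B}
    (h : IsStrictHom a b f) : PreservesShapes J f.toFunctor :=
  ((Ψ.isStrictHom_iff a b f).1 h).preservesShapes

/-- The free algebra is equivalent to the free category with chosen limits. -/
theorem exists_equivalence (A : Cat.{v, v + 1}) :
    ∃ (I : A ⟶ Cat.of (FreeLimits J A)) (U : Cat.of (FreeLimits J A) ⟶ S.functor.obj A),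
      I.toFunctor = incl J A ∧ U.toFunctor.IsEquivalence ∧ I ≫ U = S.e A := by
  obtain ⟨I, hI⟩ : ∃ I : A ⟶ Cat.of (FreeLimits J A), I.toFunctor = incl J A :=
    ⟨(incl J A).toCatHom, rfl⟩
  let b : S.Alg (Cat.of (FreeLimits J A)) := (Ψ.equiv _).symm (chosen J A)
  have hb : Ψ.equiv _ b = chosen J A := Equiv.apply_symm_apply _ _
  let U : Cat.of (FreeLimits J A) ⟶ S.functor.obj A :=
    (ext (Ψ.equiv _ (S.freeAlg A)) (S.e A).toFunctor).toCatHom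
  have hU : I ≫ U = S.e A := Cat.ext ((congr_arg (· ⋙ U.toFunctor) hI).trans (incl_ext _ _))
  have hU' : IsStrictHom b (S.freeAlg A) U := by
    rw [Ψ.isStrictHom_iff, hb]
    exact ext_strictlyPreserved _ _
  let V : S.functor.obj A ⟶ Cat.of (FreeLimits J A) := S.functor.map I ≫ b.str
  have hV' : IsStrictHom (S.freeAlg A) b V := (isStrictHom_map _).comp (isStrictHom_str b)
  have hV : S.e A ≫ V = I := by
    rw [← Strict.assoc, ← S.e_natural, Strict.assoc, b.e_str, Strict.comp_id]
  -- Both composites fix the generators, so each is an identity by the uniqueness part of a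
  -- universal property: that of the free `S`-algebra here, that of formal limits for `U ≫ V`.
  have hVU : V ≫ U = 𝟙 _ := (hV'.comp hU').hom_ext (IsStrictHom.id _) (by
    rw [← Strict.assoc, hV, hU, Strict.comp_id])
  have hUV : U ≫ V = 𝟙 _ := by
    have h := (Ψ.isStrictHom_iff _ _ _).1 (hU'.comp hV')
    rw [hb] at h
    refine Cat.ext (functor_ext h (.id _) ?_)
    rw [← hI]
    exact congr_arg (·.toFunctor) (show I ≫ U ≫ V = I ≫ 𝟙 _ by
      rw [← Strict.assoc, hU, hV, Strict.comp_id])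
  refine ⟨I, U, hI, ?_, hU⟩
  exact (CategoryTheory.Equivalence.mk U.toFunctor V.toFunctor
    (eqToIso (congr_arg (·.toFunctor) hUV).symm)
    (eqToIso (congr_arg (·.toFunctor) hVU))).isEquivalence_functor

/-- The property is `whiskerLeft_incl_bijective`, transported along the equivalence `U`, which is
compatible with the inclusions of `A`. -/
theorem bijective {A B : Cat.{v, v + 1}} (g : S.functor.obj A ⟶ B) {h : S.functor.obj A ⟶ B}
    (hh : PreservesShapes J h.toFunctor) :
    Function.Bijective fun β : g ⟶ h => S.e A ◁ β := by
  obtain ⟨I, U, hI, hU, hU'⟩ := Ψ.exists_equivalence A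
  have hUh : PreservesShapes J (U.toFunctor ⋙ h.toFunctor) :=
    (PreservesShapes.of_isEquivalence U.toFunctor).comp hh
  have h₁ := whiskerLeft_incl_bijective (U.toFunctor ⋙ g.toFunctor) hUh
  have h₂ : Function.Bijective fun β : g.toFunctor ⟶ h.toFunctor =>
      Functor.whiskerLeft U.toFunctor β :=
    (Functor.FullyFaithful.ofFullyFaithful
      ((Functor.whiskeringLeft _ _ B).obj U.toFunctor)).map_bijective _ _
  rw [← hI] at h₁
  rw [← hU']
  constructor
  · intro β γ w
    exact Cat.Hom₂.ext (h₂.1 (h₁.1 (congr_arg (·.toNatTrans) w)))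
  · intro α
    obtain ⟨β', hβ'⟩ := h₁.2 α.toNatTrans
    obtain ⟨β, rfl⟩ := h₂.2 β'
    exact ⟨⟨β⟩, Cat.Hom₂.ext hβ'⟩

/-- Pseudomorphisms preserve limits. -/
theorem preservesShapes_of_pseudoHom {A B : Cat.{v, v + 1}} {a : S.Alg A} {b : S.Alg B}
    {f : A ⟶ B} (φ : PseudoHom a b f) : PreservesShapes J f.toFunctor := by
  have ha := Ψ.preservesShapes (isStrictHom_str a)
  have h : PreservesShapes J (a.str.toFunctor ⋙ f.toFunctor) :=
    (Ψ.preservesShapes ((isStrictHom_map f).comp (isStrictHom_str b))).of_iso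
      (Cat.Hom.toNatIso φ.cell)
  have he : (S.e A).toFunctor ⋙ a.str.toFunctor = 𝟭 A := congr_arg (·.toFunctor) a.e_str
  intro i
  have := ha i
  have := h i
  refine ⟨fun {D} => ?_⟩
  -- Every diagram in `A` is the image under `a` of a diagram in the free algebra. Since `a` and `a
  -- ≫ f` preserve limits, a limit cone upstairs yields a limit cone over `D` whose image under `f`
  -- is again a limit.
  have hD : (D ⋙ (S.e A).toFunctor) ⋙ a.str.toFunctor = D :=
    (congr_arg (D ⋙ ·) he).trans D.comp_id
  obtain ⟨hc⟩ := (Ψ.equiv _ (S.freeAlg A)).isLimit i (D ⋙ (S.e A).toFunctor)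
  have : PreservesLimit ((D ⋙ (S.e A).toFunctor) ⋙ a.str.toFunctor) f.toFunctor :=
    preservesLimit_of_preserves_limit_cone (isLimitOfPreserves a.str.toFunctor hc)
      (isLimitOfPreserves (a.str.toFunctor ⋙ f.toFunctor) hc)
  rwa [hD] at this

/-- Limit-preserving functors are pseudomorphisms. -/
theorem nonempty_pseudoHom {A B : Cat.{v, v + 1}} (a : S.Alg A) (b : S.Alg B) {f : A ⟶ B}
    (hf : PreservesShapes J f.toFunctor) : Nonempty (PseudoHom a b f) := by
  have h : PreservesShapes J (a.str ≫ f).toFunctor :=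
    (Ψ.preservesShapes (isStrictHom_str a)).comp hf
  exact TwoMonad.nonempty_pseudoHom
    (fun g => Ψ.bijective g (Ψ.preservesShapes ((isStrictHom_map f).comp (isStrictHom_str b))))
    (fun g => Ψ.bijective g h)
    (fun g => (Ψ.bijective g ((Ψ.preservesShapes (isStrictHom_map a.str)).comp h)).1)

/-- All 2-cells between pseudomorphisms are algebra 2-cells. -/
theorem isAlgTwoCell {A B : Cat.{v, v + 1}} {a : S.Alg A} {b : S.Alg B} {f g : A ⟶ B}
    (φ : PseudoHom a b f) (ψ : PseudoHom a b g) (α : f ⟶ g) : IsAlgTwoCell φ ψ α :=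
  isAlgTwoCell_of_injective φ ψ α fun _ _ w => (Ψ.bijective _
    ((Ψ.preservesShapes (isStrictHom_str a)).comp (Ψ.preservesShapes_of_pseudoHom ψ))).1 w

end LimitAlgebras

end TwoMonad

/-- The characterisation of the algebras for the 2-monad of free categories with chosen limits. -/
noncomputable def freeLimits.limitAlgebras {ι : Type} (J : ι → Type) [∀ i, SmallCategory (J i)] :
    (freeLimits.{v} J).monad.LimitAlgebras J where
  equiv := freeLimits.algEquiv J
  isStrictHom_iff := freeLimits.isStrictHom_iff

/-! ### Terminal objects, products and pullbacks as limits of shapes -/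

section
variable {K : Type} [SmallCategory K] {A : Type u} [Category.{v} A] {B : Type u'} [Category.{v'} B]

theorem cone_eq_iff {D : K ⥤ A} {c d : Cone D} :
    c = d ↔ ∃ h : c.pt = d.pt, ∀ k, c.π.app k = eqToHom h ≫ d.π.app k := by
  constructor
  · rintro rfl
    exact ⟨rfl, fun _ => (Category.id_comp _).symm⟩
  · rintro ⟨h, w⟩
    obtain ⟨p, π⟩ := c
    obtain ⟨q, ρ⟩ := d
    obtain rfl : p = q := h
    congr 1
    ext k
    exact (w k).trans (Category.id_comp _)

/-- The cone over an empty diagram with a given vertex. -/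
def emptyCone (D : Discrete PEmpty.{1} ⥤ A) (p : A) : Cone D where
  pt := p
  π := { app k := k.as.elim
         naturality k := k.as.elim }

/-- The cone over a diagram of shape `Discrete WalkingPair` with given legs. -/
def pairCone (D : Discrete WalkingPair ⥤ A) {p : A} (a : p ⟶ D.obj ⟨.left⟩)
    (b : p ⟶ D.obj ⟨.right⟩) : Cone D where
  pt := p
  π := Discrete.natTrans fun k => match k with
    | ⟨.left⟩ => a
    | ⟨.right⟩ => b

/-- The cone over a diagram of shape `WalkingCospan` with given legs. -/
def cospanCone (D : WalkingCospan ⥤ A) {p : A} (a : p ⟶ D.obj .left) (b : p ⟶ D.obj .right)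
    (w : a ≫ D.map WalkingCospan.Hom.inl = b ≫ D.map WalkingCospan.Hom.inr) : Cone D where
  pt := p
  π := { app k := match k with
          | none => a ≫ D.map WalkingCospan.Hom.inl
          | some .left => a
          | some .right => b
         naturality := by
          rintro k l (_ | (_ | _))
          · refine (Category.id_comp _).trans ((Category.comp_id _).symm.trans ?_)
            exact congr_arg _ (D.map_id k).symm
          · exact Category.id_comp _
          · exact (Category.id_comp _).trans w }

theorem exists_eq_pair (D : Discrete WalkingPair ⥤ A) : ∃ X Y, D = pair X Y :=
  ⟨D.obj ⟨.left⟩, D.obj ⟨.right⟩, CategoryTheory.Functor.ext (by rintro ⟨_ | _⟩ <;> rfl) (by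
    rintro ⟨j⟩ ⟨k⟩ u
    obtain rfl : j = k := Discrete.eq_of_hom u
    obtain rfl : u = 𝟙 _ := Subsingleton.elim _ _
    simp)⟩

theorem exists_eq_cospan (D : WalkingCospan ⥤ A) :
    ∃ (X Y Z : A) (f : X ⟶ Z) (g : Y ⟶ Z), D = cospan f g := by
  have h (E : WalkingCospan ⥤ A) (k : WalkingCospan) (p : D.obj k = E.obj k) :
      D.map (𝟙 k) = eqToHom p ≫ E.map (𝟙 k) ≫ eqToHom p.symm := by
    rw [D.map_id, E.map_id, Category.id_comp, eqToHom_trans, eqToHom_refl]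
  refine ⟨_, _, _, D.map WalkingCospan.Hom.inl, D.map WalkingCospan.Hom.inr,
    CategoryTheory.Functor.ext (by rintro (_ | _ | _) <;> rfl) ?_⟩
  rintro k l (_ | (_ | _))
  · exact h _ k _
  · exact ((Category.id_comp _).trans (Category.comp_id _)).symm
  · exact ((Category.id_comp _).trans (Category.comp_id _)).symm

end

/-- The empty shape. -/
abbrev terminalShapes : Unit → Type := fun _ => Discrete PEmpty.{1}

/-- The empty shape together with a given shape. -/
def withTerminalShape (P : Type) : Bool → Type
  | false => Discrete PEmpty.{1}
  | true => P

instance (P : Type) [SmallCategory P] : ∀ i, SmallCategory (withTerminalShape P i)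
  | false => inferInstanceAs (SmallCategory (Discrete PEmpty.{1}))
  | true => inferInstanceAs (SmallCategory P)

section
variable {A : Type u} [Category.{v} A] {B : Type u} [Category.{v} B]

theorem nonempty_isLimit_emptyCone (D : Discrete PEmpty.{1} ⥤ A) {p : A}
    (h : Nonempty (IsTerminal p)) : Nonempty (IsLimit (emptyCone D p)) :=
  ⟨isLimitChangeEmptyCone A h.some _ (Iso.refl _)⟩

theorem emptyCone_pt {D : Discrete PEmpty.{1} ⥤ A} (c : Cone D) : emptyCone D c.pt = c :=
  cone_eq_iff.2 ⟨rfl, fun k => k.as.elim⟩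

theorem mapCone_emptyCone (F : A ⥤ B) (D : Discrete PEmpty.{1} ⥤ A) (p : A) :
    F.mapCone (emptyCone D p) = emptyCone (D ⋙ F) (F.obj p) :=
  cone_eq_iff.2 ⟨rfl, fun k => k.as.elim⟩

theorem cone_empty_pt (D : Discrete PEmpty.{1} ⥤ A)
    (c : ∀ D : Discrete PEmpty.{1} ⥤ A, Cone D) :
    emptyCone D (c (Functor.empty A)).pt = c D := by
  obtain rfl : D = Functor.empty A := Functor.empty_ext' _ _
  exact emptyCone_pt _

/-- A chosen terminal object, as a choice of limits. -/
def ChosenTerminal.toChosenLimits : ChosenTerminal A ≃ ChosenLimits terminalShapes A where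
  toFun c :=
    { cone _ D := emptyCone D c.top
      isLimit _ D := nonempty_isLimit_emptyCone D c.isTerminal }
  invFun c :=
    { top := (c.cone () (Functor.empty A)).pt
      isTerminal := ⟨isLimitChangeEmptyCone A (c.isLimit () (Functor.empty A)).some _ (Iso.refl _)⟩ }
  left_inv _ := rfl
  right_inv c := ChosenLimits.ext' fun _ D => cone_empty_pt D (c.cone ())

theorem ChosenTerminal.strictlyPreserved_iff (a : ChosenTerminal A) (b : ChosenTerminal B)
    (F : A ⥤ B) : a.StrictlyPreserved b F ↔
      a.toChosenLimits.StrictlyPreserved b.toChosenLimits F :=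
  ⟨fun h _ D => (mapCone_emptyCone F D _).trans (congr_arg _ h),
    fun h => congr_arg Cone.pt (h () (Functor.empty A))⟩

theorem nonempty_isLimit_pairCone (D : Discrete WalkingPair ⥤ A) {p : A} (a : p ⟶ D.obj ⟨.left⟩)
    (b : p ⟶ D.obj ⟨.right⟩) (h : Nonempty (IsLimit (BinaryFan.mk a b))) :
    Nonempty (IsLimit (pairCone D a b)) :=
  ⟨IsLimit.ofIsoLimit ((IsLimit.postcomposeInvEquiv (diagramIsoPair D) _).symm h.some)
    (Cone.ext (Iso.refl _) (by rintro ⟨_ | _⟩ <;> simp [pairCone]))⟩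

theorem pairCone_eq_iff (D : Discrete WalkingPair ⥤ A) {p : A} (a : p ⟶ D.obj ⟨.left⟩)
    (b : p ⟶ D.obj ⟨.right⟩) (c : Cone D) : c = pairCone D a b ↔ ∃ h : c.pt = p,
      c.π.app ⟨.left⟩ = eqToHom h ≫ a ∧ c.π.app ⟨.right⟩ = eqToHom h ≫ b := by
  rw [cone_eq_iff]
  refine exists_congr fun h => ⟨fun w => ⟨w ⟨.left⟩, w ⟨.right⟩⟩, fun w => ?_⟩
  rintro ⟨_ | _⟩
  · exact w.1
  · exact w.2

/-- Chosen finite products, as a choice of limits. -/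
def ChosenFiniteProducts.toChosenLimits : ChosenFiniteProducts A ≃
    ChosenLimits (withTerminalShape (Discrete WalkingPair)) A where
  toFun c :=
    { cone i := match i with
        | false => fun D => emptyCone D c.top
        | true => fun D => pairCone D (c.fst _ _) (c.snd _ _)
      isLimit i := match i with
        | false => fun D => nonempty_isLimit_emptyCone D c.isTerminal
        | true => fun D => nonempty_isLimit_pairCone D _ _ (c.isLimit _ _) }
  invFun c :=
    { top := (c.cone false (Functor.empty A)).pt
      isTerminal := ⟨isLimitChangeEmptyCone A (c.isLimit false (Functor.empty A)).some _
        (Iso.refl _)⟩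
      prod X Y := (c.cone true (pair X Y)).pt
      fst X Y := (c.cone true (pair X Y)).π.app (⟨.left⟩ : Discrete WalkingPair)
      snd X Y := (c.cone true (pair X Y)).π.app (⟨.right⟩ : Discrete WalkingPair)
      isLimit X Y := ⟨IsLimit.ofIsoLimit (c.isLimit true (pair X Y)).some (isoBinaryFanMk _)⟩ }
  left_inv _ := rfl
  right_inv c := ChosenLimits.ext' fun i => match i with
    | false => fun D => cone_empty_pt D (c.cone false)
    | true => fun D => by
      obtain ⟨X, Y, rfl⟩ := exists_eq_pair D
      exact ((pairCone_eq_iff _ _ _ _).2 ⟨rfl, (Category.id_comp _).symm,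
        (Category.id_comp _).symm⟩).symm

theorem ChosenFiniteProducts.strictlyPreserved_iff (a : ChosenFiniteProducts A)
    (b : ChosenFiniteProducts B) (F : A ⥤ B) : a.StrictlyPreserved b F ↔
      a.toChosenLimits.StrictlyPreserved b.toChosenLimits F := by
  constructor
  · rintro ⟨h₀, h⟩
    exact fun i => match i with
      | false => fun D => (mapCone_emptyCone F D _).trans (congr_arg _ h₀)
      | true => fun D => (pairCone_eq_iff _ _ _ _).2 (h _ _)
  · intro h
    exact ⟨congr_arg Cone.pt (h false (Functor.empty A)),
      fun X Y => (pairCone_eq_iff _ _ _ _).1 (h true (pair X Y))⟩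

theorem nonempty_isLimit_cospanCone (D : WalkingCospan ⥤ A) {p : A} {a : p ⟶ D.obj .left}
    {b : p ⟶ D.obj .right}
    (h : IsPullback a b (D.map WalkingCospan.Hom.inl) (D.map WalkingCospan.Hom.inr)) :
    Nonempty (IsLimit (cospanCone D a b h.w)) :=
  ⟨IsLimit.ofIsoLimit ((IsLimit.postcomposeInvEquiv (diagramIsoCospan D) _).symm h.isLimit)
    (Cone.ext (Iso.refl _) (by
      rintro (_ | _ | _)
      all_goals exact (Category.comp_id _).trans (Category.id_comp _).symm))⟩

theorem cospanCone_eq_iff (D : WalkingCospan ⥤ A) {p : A} (a : p ⟶ D.obj .left)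
    (b : p ⟶ D.obj .right) (w : a ≫ D.map WalkingCospan.Hom.inl = b ≫ D.map WalkingCospan.Hom.inr)
    (c : Cone D) : c = cospanCone D a b w ↔ ∃ h : c.pt = p,
      c.π.app .left = eqToHom h ≫ a ∧ c.π.app .right = eqToHom h ≫ b := by
  rw [cone_eq_iff]
  refine exists_congr fun h => ⟨fun w => ⟨w .left, w .right⟩, fun w => ?_⟩
  rintro (_ | _ | _)
  -- The leg to the apex of the cospan is determined by the left leg.
  · refine (c.w WalkingCospan.Hom.inl).symm.trans ?_
    rw [w.1, Category.assoc]
    rfl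
  · exact w.1
  · exact w.2

/-- Chosen finite limits, as a choice of limits. -/
def ChosenFiniteLimits.toChosenLimits : ChosenFiniteLimits A ≃
    ChosenLimits (withTerminalShape WalkingCospan) A where
  toFun c :=
    { cone i := match i with
        | false => fun D => emptyCone D c.top
        | true => fun D => cospanCone D _ _ (c.isPullback _ _).w
      isLimit i := match i with
        | false => fun D => nonempty_isLimit_emptyCone D c.isTerminal
        | true => fun D => nonempty_isLimit_cospanCone D (c.isPullback _ _) }
  invFun c :=
    { top := (c.cone false (Functor.empty A)).pt
      isTerminal := ⟨isLimitChangeEmptyCone A (c.isLimit false (Functor.empty A)).some _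
        (Iso.refl _)⟩
      pullback f g := (c.cone true (cospan f g)).pt
      fst f g := (c.cone true (cospan f g)).π.app WalkingCospan.left
      snd f g := (c.cone true (cospan f g)).π.app WalkingCospan.right
      isPullback f g := IsPullback.of_isLimit (c := c.cone true (cospan f g))
        (c.isLimit true (cospan f g)).some }
  left_inv _ := rfl
  right_inv c := ChosenLimits.ext' fun i => match i with
    | false => fun D => cone_empty_pt D (c.cone false)
    | true => fun D => by
      obtain ⟨X, Y, Z, f, g, rfl⟩ := exists_eq_cospan D
      exact ((cospanCone_eq_iff (cospan f g) _ _ (PullbackCone.condition (c.cone true (cospan f g)))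
        _).2 ⟨rfl, (Category.id_comp _).symm,
        (Category.id_comp _).symm⟩).symm

theorem ChosenFiniteLimits.strictlyPreserved_iff (a : ChosenFiniteLimits A)
    (b : ChosenFiniteLimits B) (F : A ⥤ B) : a.StrictlyPreserved b F ↔
      a.toChosenLimits.StrictlyPreserved b.toChosenLimits F := by
  constructor
  · rintro ⟨h₀, h⟩
    exact fun i => match i with
      | false => fun D => (mapCone_emptyCone F D _).trans (congr_arg _ h₀)
      | true => fun D => (cospanCone_eq_iff (D ⋙ F) _ _ (b.isPullback _ _).w _).2 (h _ _)
  · intro h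
    exact ⟨congr_arg Cone.pt (h false (Functor.empty A)),
      fun f g => (cospanCone_eq_iff (cospan f g ⋙ F) _ _ (b.isPullback _ _).w _).1
        (h true (cospan f g))⟩

end

/-! ### Limits preserved by cocontinuous functors on presheaves -/

section
variable {X : Type v} [SmallCategory X]

/-- Cocontinuous functors on presheaves that agree on representables are isomorphic. -/
theorem PresheafPseudomonad.nonempty_iso {E : Type u} [Category.{v} E] [HasColimitsOfSize.{v, v} E]
    (L G : (Xᵒᵖ ⥤ Type v) ⥤ E) [PreservesColimitsOfSize.{v, v} L]
    [PreservesColimitsOfSize.{v, v} G] (e : yoneda ⋙ L ≅ yoneda ⋙ G) : Nonempty (L ≅ G) := by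
  obtain ⟨p, hp⟩ := (whiskerLeft_yoneda_bijective L G).2 e.hom
  obtain ⟨q, hq⟩ := (whiskerLeft_yoneda_bijective G L).2 e.inv
  dsimp only at hp hq
  refine ⟨p, q, (whiskerLeft_yoneda_bijective L L).1 ?_, (whiskerLeft_yoneda_bijective G G).1 ?_⟩
  · simp only [Functor.whiskerLeft_comp, hp, hq, Iso.hom_inv_id]
    rfl
  · simp only [Functor.whiskerLeft_comp, hp, hq, Iso.inv_hom_id]
    rfl

/-- The functor on presheaves taking the colimit over the category of elements of `g`. -/
noncomputable def elementsColimit (g : X ⥤ Type v) : (Xᵒᵖ ⥤ Type v) ⥤ Type v :=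
  (Functor.whiskeringLeft _ _ _).obj (CategoryOfElements.π g).op ⋙ colim

namespace elementsColimit
variable (g : X ⥤ Type v)

instance : PreservesColimitsOfSize.{v, v} (elementsColimit g) :=
  inferInstanceAs (PreservesColimitsOfSize.{v, v}
    ((Functor.whiskeringLeft _ _ _).obj (CategoryOfElements.π g).op ⋙ colim))

/-- The colimit cocone over the elements of `g` for a representable presheaf. -/
def cocone (c : X) : Cocone ((CategoryOfElements.π g).op ⋙ yoneda.obj c) where
  pt := g.obj c
  ι := { app e := TypeCat.ofHom fun (u : e.unop.1 ⟶ c) => g.map u e.unop.2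
         naturality e e' f := by
          ext (u : e.unop.1 ⟶ c)
          have h : g.map f.unop.1 e'.unop.2 = e.unop.2 := f.unop.2
          exact (ConcreteCategory.congr_hom (g.map_comp f.unop.1 u) e'.unop.2).trans
            (congr_arg (g.map u) h) }

/-- The cocone is a colimit. -/
def isColimit (c : X) : IsColimit (cocone g c) where
  desc s := TypeCat.ofHom fun r : g.obj c =>
    s.ι.app (op (⟨c, r⟩ : g.Elements)) (𝟙 c)
  fac s e := by
    ext (u : e.unop.1 ⟶ c)
    -- In the colimit, `u` in the copy of `yoneda.obj c` indexed by `e` is identified, along `u`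
    -- itself, with `𝟙 c` in the copy indexed by the element `g.map u e.unop.2` over `c`.
    have h := ConcreteCategory.congr_hom (s.w (Quiver.Hom.op (X := (e.unop : g.Elements))
      (Y := (⟨c, g.map u e.unop.2⟩ : g.Elements)) ⟨u, rfl⟩)) (𝟙 c)
    refine h.symm.trans ?_
    exact congr_arg (s.ι.app e) (Category.comp_id u)
  uniq s m hm := by
    ext (r : g.obj c)
    refine .trans ?_ (ConcreteCategory.congr_hom (hm (op (⟨c, r⟩ : g.Elements))) (𝟙 c))
    change m r = m (g.map (𝟙 c) r)
    simp

/-- The colimit over the elements of `g` extends `g`. -/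
noncomputable def yonedaIso : yoneda ⋙ elementsColimit g ≅ g :=
  NatIso.ofComponents (fun c => (colimit.isColimit _).coconePointUniqueUpToIso (isColimit g c))
    (fun {c d} f => (colimit.isColimit ((CategoryOfElements.π g).op ⋙ yoneda.obj c)).hom_ext
      fun e => by
        have h₁ (c : X) := (colimit.isColimit ((CategoryOfElements.π g).op ⋙
          yoneda.obj c)).comp_coconePointUniqueUpToIso_hom (isColimit g c) e
        refine (ι_colimMap_assoc _ _ _).trans ?_
        refine (congr_arg (_ ≫ ·) (h₁ d)).trans (.trans ?_ (Category.assoc _ _ _))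
        refine .trans ?_ (congr_arg (· ≫ g.map f) (h₁ c)).symm
        ext (u : e.unop.1 ⟶ c)
        exact ConcreteCategory.congr_hom (g.map_comp u f) e.unop.2)

/-- As `g` preserves finite products, its category of elements has them. The opposite then has
finite coproducts and is therefore sifted, so colimits of sets over it commute with finite products.
-/
theorem preserves_products [HasFiniteProducts X] [PreservesFiniteProducts g] :
    PreservesFiniteProducts (elementsColimit g) := by
  have : HasFiniteProducts g.Elements := ⟨fun n => inferInstance⟩
  have : HasFiniteCoproducts g.Elementsᵒᵖ := inferInstance
  have : Nonempty g.Elementsᵒᵖ := ⟨op (⊤_ g.Elements)⟩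
  have : IsSifted g.Elementsᵒᵖ := inferInstance
  exact ⟨fun n => inferInstanceAs (PreservesLimitsOfShape _
    ((Functor.whiskeringLeft _ _ _).obj (CategoryOfElements.π g).op ⋙ colim))⟩

/-- The elements of a finite-limit-preserving functor form a cofiltered category, and filtered
colimits of sets commute with finite limits. -/
theorem preserves_limits [HasFiniteLimits X] [PreservesFiniteLimits g] :
    PreservesFiniteLimits (elementsColimit g) := by
  have : IsCofiltered g.Elements := g.isCofiltered_elements
  have : PreservesFiniteLimits (colim : (g.Elementsᵒᵖ ⥤ Type v) ⥤ Type v) := inferInstance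
  exact inferInstanceAs (PreservesFiniteLimits
    ((Functor.whiskeringLeft _ _ _).obj (CategoryOfElements.π g).op ⋙ colim))

end elementsColimit
end

section
variable {A : Type u} [Category.{v} A] {B : Type u'} [Category.{v'} B]

theorem hasFiniteProducts_of_withTerminalShape
    (h : ∀ i, HasLimitsOfShape (withTerminalShape (Discrete WalkingPair) i) A) :
    HasFiniteProducts A :=
  have : HasTerminal A := h false
  have : HasBinaryProducts A := h true
  hasFiniteProducts_of_has_binary_and_terminal

theorem hasFiniteLimits_of_withTerminalShape
    (h : ∀ i, HasLimitsOfShape (withTerminalShape WalkingCospan i) A) : HasFiniteLimits A :=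
  have : HasTerminal A := h false
  have : HasPullbacks A := h true
  hasFiniteLimits_of_hasTerminal_and_pullbacks

theorem preservesShapes_withTerminalShape_pair_iff [HasFiniteProducts A] (F : A ⥤ B) :
    PreservesShapes (withTerminalShape (Discrete WalkingPair)) F ↔ PreservesFiniteProducts F := by
  refine ⟨fun h => ?_, fun h i => match i with
    | false => inferInstanceAs (PreservesLimitsOfShape (Discrete PEmpty.{1}) F)
    | true => inferInstanceAs (PreservesLimitsOfShape (Discrete WalkingPair) F)⟩
  have : PreservesLimitsOfShape (Discrete PEmpty.{1}) F := h false
  have : PreservesLimitsOfShape (Discrete WalkingPair) F := h true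
  exact .of_preserves_binary_and_terminal F

theorem preservesShapes_withTerminalShape_cospan_iff [HasFiniteLimits A] (F : A ⥤ B) :
    PreservesShapes (withTerminalShape WalkingCospan) F ↔ PreservesFiniteLimits F := by
  refine ⟨fun h => ?_, fun h i => match i with
    | false => inferInstanceAs (PreservesLimitsOfShape (Discrete PEmpty.{1}) F)
    | true => inferInstanceAs (PreservesLimitsOfShape WalkingCospan F)⟩
  have : PreservesLimitsOfShape (Discrete PEmpty.{1}) F := h false
  have : PreservesLimitsOfShape WalkingCospan F := h true
  exact preservesFiniteLimits_of_preservesTerminal_and_pullbacks F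

end

/-- Cocontinuous functors between presheaf categories preserve limits of shapes `J` as soon as
their restrictions to representables do. -/
def PreservedByExtension {ι : Type} (J : ι → Type) [∀ i, SmallCategory (J i)] : Prop :=
  ∀ {X Y : Type v} [SmallCategory X] [SmallCategory Y] (L : (Xᵒᵖ ⥤ Type v) ⥤ Yᵒᵖ ⥤ Type v)
    [PreservesColimitsOfSize.{v, v} L], (∀ i, HasLimitsOfShape (J i) X) →
      PreservesShapes J (yoneda ⋙ L) → PreservesShapes J L

/-- The terminal presheaf is represented by the terminal object of `X`, so its image under `L` is
already controlled by `yoneda ⋙ L`. -/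
theorem preservedByExtension_terminal : PreservedByExtension.{v} terminalShapes := by
  intro X Y _ _ L _ hX hF i
  have : HasTerminal X := hX ()
  have hF : PreservesLimitsOfShape (Discrete PEmpty.{1}) (yoneda ⋙ L) := hF ()
  have : PreservesLimit (Functor.empty (Xᵒᵖ ⥤ Type v)) L := preservesTerminal_of_iso L
    (L.mapIso (PreservesTerminal.iso (yoneda (C := X))).symm ≪≫ PreservesTerminal.iso (yoneda ⋙ L))
  exact preservesLimitsOfShape_pempty_of_preservesTerminal L

section
variable {X Y : Type v} [SmallCategory X] [SmallCategory Y] (L : (Xᵒᵖ ⥤ Type v) ⥤ Yᵒᵖ ⥤ Type v)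
  [PreservesColimitsOfSize.{v, v} L]

/-- Both functors are cocontinuous and they agree on representables. Limits of presheaves are
computed pointwise, so this reduces preservation by `L` to preservation by colimits over elements.
-/
theorem nonempty_elementsColimit_iso_evaluation (y : Yᵒᵖ) :
    Nonempty (elementsColimit (yoneda ⋙ L ⋙ (evaluation _ _).obj y) ≅
      L ⋙ (evaluation _ _).obj y) :=
  PresheafPseudomonad.nonempty_iso _ _ (elementsColimit.yonedaIso _)

theorem preservesFiniteProducts_of_yoneda [HasFiniteProducts X]
    (h : PreservesFiniteProducts (yoneda ⋙ L)) : PreservesFiniteProducts L := by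
  refine ⟨fun n => preservesLimitsOfShape_of_evaluation _ _ fun y => ?_⟩
  obtain ⟨e⟩ := nonempty_elementsColimit_iso_evaluation L y
  have : PreservesFiniteProducts (yoneda ⋙ L ⋙ (evaluation Yᵒᵖ (Type v)).obj y) :=
    ⟨fun n => inferInstanceAs (PreservesLimitsOfShape (Discrete (Fin n))
      ((yoneda ⋙ L) ⋙ (evaluation Yᵒᵖ (Type v)).obj y))⟩
  have := elementsColimit.preserves_products (yoneda ⋙ L ⋙ (evaluation Yᵒᵖ (Type v)).obj y)
  exact preservesLimitsOfShape_of_natIso e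

theorem preservesFiniteLimits_of_yoneda [HasFiniteLimits X]
    (h : PreservesFiniteLimits (yoneda ⋙ L)) : PreservesFiniteLimits L := by
  refine ⟨fun K _ _ => preservesLimitsOfShape_of_evaluation _ _ fun y => ?_⟩
  obtain ⟨e⟩ := nonempty_elementsColimit_iso_evaluation L y
  have : PreservesFiniteLimits (yoneda ⋙ L ⋙ (evaluation Yᵒᵖ (Type v)).obj y) :=
    inferInstanceAs (PreservesFiniteLimits ((yoneda ⋙ L) ⋙ (evaluation Yᵒᵖ (Type v)).obj y))
  have := elementsColimit.preserves_limits (yoneda ⋙ L ⋙ (evaluation Yᵒᵖ (Type v)).obj y)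
  exact preservesLimitsOfShape_of_natIso e

end

theorem preservedByExtension_finiteProducts :
    PreservedByExtension.{v} (withTerminalShape (Discrete WalkingPair)) := by
  intro X Y _ _ L _ hX h
  have := hasFiniteProducts_of_withTerminalShape hX
  rw [preservesShapes_withTerminalShape_pair_iff] at h ⊢
  exact preservesFiniteProducts_of_yoneda L h

theorem preservedByExtension_finiteLimits :
    PreservedByExtension.{v} (withTerminalShape WalkingCospan) := by
  intro X Y _ _ L _ hX h
  have := hasFiniteLimits_of_withTerminalShape hX
  rw [preservesShapes_withTerminalShape_cospan_iff] at h ⊢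
  exact preservesFiniteLimits_of_yoneda L h

/-! ### Lifting the presheaf pseudomonad -/

section
variable {ι : Type} {J : ι → Type} [∀ i, SmallCategory (J i)]

theorem ChosenLimits.hasLimitsOfShape {A : Type u} [Category.{v} A] (c : ChosenLimits J A) (i : ι) :
    HasLimitsOfShape (J i) A :=
  ⟨fun D => ⟨⟨⟨_, (c.isLimit i D).some⟩⟩⟩⟩

variable (J) in
/-- A choice of limits in a category of presheaves. -/
noncomputable def chosenLimitsPresheaf (X : Type v) [SmallCategory X] :
    ChosenLimits J (Xᵒᵖ ⥤ Type v) where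
  cone _ D := limit.cone D
  isLimit _ D := ⟨limit.isLimit D⟩

namespace PresheafPseudomonad

instance (X : Cat.{v, v}) : (ULift.downFunctor : ULift.{v + 1} X ⥤ X).IsEquivalence :=
  (ULift.equivalence (C := X)).isEquivalence_inverse

instance (X : Cat.{v, v}) : (ULift.upFunctor : X ⥤ ULift.{v + 1} X).IsEquivalence :=
  (ULift.equivalence (C := X)).isEquivalence_functor

theorem preservesShapes_unit (X : Cat.{v, v}) : PreservesShapes J (unit X).toFunctor := fun i =>
  inferInstanceAs (PreservesLimitsOfShape (J i)
    ((ULift.downFunctor : ULift.{v + 1} X ⥤ X) ⋙ yoneda))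

/-- The unit of the Kan extension is invertible, so the restriction of `lan f` to representables is
`f` up to isomorphism and `hJ` applies. The limits required in `X` are transferred from its lifted
copy. -/
theorem preservesShapes_lan (hJ : PreservedByExtension.{v} J) {X Y : Cat.{v, v}}
    (c : ChosenLimits J (catInclusion.{v}.obj X)) {f : catInclusion.obj X ⟶ psh Y}
    (hf : PreservesShapes J f.toFunctor) : PreservesShapes J (lan f).toFunctor := by
  have hf' : PreservesShapes J (toFun f) := (PreservesShapes.of_isEquivalence _).comp hf
  refine hJ (yoneda.leftKanExtension (toFun f)) (fun i => ?_)
    (hf'.of_iso (asIso (yoneda.leftKanExtensionUnit (toFun f))))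
  have : HasLimitsOfShape (J i) (ULift.{v + 1} X) := c.hasLimitsOfShape i
  exact Adjunction.hasLimitsOfShape_of_equivalence (ULift.upFunctor : X ⥤ ULift.{v + 1} X)

end PresheafPseudomonad

open PresheafPseudomonad

/-- The presheaf pseudomonad lifts to categories with limits of shapes `J`. -/
noncomputable def TwoMonad.LimitAlgebras.presheafLifting {S : TwoMonad Cat.{v, v + 1}}
    (Ψ : S.LimitAlgebras J) (hJ : PreservedByExtension.{v} J) :
    StrictLifting presheafPseudomonad.{v} S where
  alg _ := (Ψ.equiv (psh _)).symm (chosenLimitsPresheaf J _)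
  star {_ _ a _ _} φ := (Ψ.nonempty_pseudoHom _ _ (preservesShapes_lan hJ (Ψ.equiv _ a)
    (Ψ.preservesShapes_of_pseudoHom φ))).some
  unit a := (Ψ.nonempty_pseudoHom a _ (preservesShapes_unit _)).some
  -- The remaining fields only assert that certain 2-cells between pseudomorphisms are algebra
  -- 2-cells, so arbitrary choices of the structures above satisfy them.
  star_map _ _ _ _ := Ψ.isAlgTwoCell _ _ _
  mu _ _ := Ψ.isAlgTwoCell _ _ _
  eta _ := Ψ.isAlgTwoCell _ _ _
  theta _ := Ψ.isAlgTwoCell _ _ _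

/-- Comparison of a kind of limits with a family of shapes. -/
structure LimitKind.Shapes (K : LimitKind) (J : ι → Type) [∀ i, SmallCategory (J i)] where
  /-- choices of limits of the kind `K` are choices of limits of shapes `J` -/
  equiv : ∀ A : Cat.{v, v + 1}, K.Chosen A ≃ ChosenLimits J A
  strictlyPreserved_iff : ∀ {A B : Cat.{v, v + 1}} (a : K.Chosen A) (b : K.Chosen B) (F : A ⟶ B),
    K.StrictlyPreserved a b F ↔ (equiv A a).StrictlyPreserved (equiv B b) F.toFunctor

namespace LimitKind.Shapes
variable {K : LimitKind}

theorem isMonadFor (s : Shapes.{v} K J) : (freeLimits.{v} J).monad.IsMonadFor K := by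
  let Ψ := freeLimits.limitAlgebras.{v} J
  refine ⟨fun A => (Ψ.equiv A).trans (s.equiv A).symm, fun a b f => ?_,
    fun a b f g hf hg α => Ψ.isAlgTwoCell _ _ α⟩
  rw [s.strictlyPreserved_iff, Ψ.isStrictHom_iff, Equiv.trans_apply, Equiv.trans_apply,
    Equiv.apply_symm_apply, Equiv.apply_symm_apply]

theorem nonempty_limitAlgebras (s : Shapes.{v} K J) {S : TwoMonad Cat.{v, v + 1}}
    (h : S.IsMonadFor K) :
    Nonempty (S.LimitAlgebras J) := by
  obtain ⟨φ, h, -⟩ := h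
  exact ⟨fun A => (φ A).trans (s.equiv A), fun a b f =>
    (h a b f).trans (s.strictlyPreserved_iff _ _ _)⟩

theorem exists_monad_and_lifting (s : Shapes.{v} K J)
    (hJ : PreservedByExtension.{v} J) :
    (∃ S : TwoMonad Cat.{v, v + 1}, S.IsMonadFor K) ∧
      ∀ S : TwoMonad Cat.{v, v + 1}, S.IsMonadFor K →
        Nonempty (StrictLifting presheafPseudomonad.{v} S) :=
  ⟨⟨_, s.isMonadFor⟩, fun _ h => (s.nonempty_limitAlgebras h).map (·.presheafLifting hJ)⟩

end LimitKind.Shapes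

/-- The shapes for terminal objects. -/
def LimitKind.terminalShapes : Shapes.{v} terminal _root_.terminalShapes where
  equiv _ := ChosenTerminal.toChosenLimits
  strictlyPreserved_iff a b F := ChosenTerminal.strictlyPreserved_iff a b F.toFunctor

/-- The shapes for finite products. -/
def LimitKind.finiteProductsShapes :
    Shapes.{v} finiteProducts (withTerminalShape (Discrete WalkingPair)) where
  equiv _ := ChosenFiniteProducts.toChosenLimits
  strictlyPreserved_iff a b F := ChosenFiniteProducts.strictlyPreserved_iff a b F.toFunctor

/-- The shapes for finite limits. -/
def LimitKind.finiteLimitsShapes :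
    Shapes.{v} finiteLimits (withTerminalShape WalkingCospan) where
  equiv _ := ChosenFiniteLimits.toChosenLimits
  strictlyPreserved_iff a b F := ChosenFiniteLimits.strictlyPreserved_iff a b F.toFunctor

end

end

/-- For each of the three kinds of limits (terminal object, finite products, finite limits) the
2-monad for categories with chosen limits of that kind exists on the 2-category of locally small
categories, and the relative pseudomonad of presheaves lifts to strict algebras for it. -/
theorem theorem7p1 (K : LimitKind) :
    (∃ S : TwoMonad Cat.{v, v + 1}, S.IsMonadFor K) ∧
      ∀ S : TwoMonad Cat.{v, v + 1}, S.IsMonadFor K →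
        Nonempty (StrictLifting presheafPseudomonad.{v} S) := by
  cases K with
  | terminal => exact LimitKind.terminalShapes.exists_monad_and_lifting preservedByExtension_terminal
  | finiteProducts =>
    exact LimitKind.finiteProductsShapes.exists_monad_and_lifting preservedByExtension_finiteProducts
  | finiteLimits =>
    exact LimitKind.finiteLimitsShapes.exists_monad_and_lifting preservedByExtension_finiteLimits
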